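/- **Theorem 4.1.** For a Schwartz function $f\in\mathcal S(\mathbb R)$ let $\widehat f(\xi)=\int_{\mathbb R}f(x)e^{-ix\xi}\,dx$ and, for $s\in\mathbb R$, $\|f\|_{H^s(\mathbb R)}=\left(\int_{\mathbb R}(1+\xi^2)^s|\widehat f(\xi)|^2\,d\xi\right)^{1/2}$. For $a>1$, $\gamma>0$ and $t>0$ put $$P^t_{a,\gamma}f(x)=\int_{\mathbb R}\widehat f(\xi)\,e^{it|\xi|^a}e^{-t^\gamma|\xi|^a}e^{ix\xi}\,d\xi,\qquad P^*_{a,\gamma}f(x)=\sup_{t\in(0,1)}|P^t_{a,\gamma}f(x)|.$$ Let $s_a^{\mathrm{loc}}(\gamma)$ be the infimum of the set of all $s>0$ for which there is a constant $C<\infty$, independent of $f$, such that $$\|P^*_{a,\gamma}f\|_{L^2([-1,1])}\le C\,\|f\|_{H^s(\mathbb R)}\qquad\text{for all } f\in\mathcal S(\mathbb R).$$ Then for all $a>1$ and $\gamma\in(0,\infty)$ this set is non-empty and $$s_a^{\mathrm{loc}}(\gamma)=\min\left(\tfrac14\,a\left(1-\tfrac1\gamma\right)^{+},\ \tfrac14\right),$$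 where $x^+=\max(0,x)$. -/

import Mathlib

open MeasureTheory Set
open scoped SchwartzMap FourierTransform ENNReal NNReal

noncomputable section

namespace ComplexTime

/-- The Fourier transform in the convention `f̂(ξ) = ∫ exp(-i x ξ) f(x) dx`, expressed through
Mathlib's transform `𝓕 f (w) = ∫ exp(-2π i x w) f(x) dx`; see `fhat_eq_integral`. -/
def fhat (f : 𝓢(ℝ, ℂ)) (ξ : ℝ) : ℂ :=
  𝓕 f (ξ / (2 * Real.pi))

theorem fhat_eq_integral (f : 𝓢(ℝ, ℂ)) (ξ : ℝ) :
    fhat f ξ = ∫ x : ℝ, Complex.exp (-(Complex.I * (x * ξ : ℝ))) * f x := by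
  rw [fhat, SchwartzMap.fourier_coe, Real.fourier_real_eq_integral_exp_smul]
  congr 1
  funext x
  rw [smul_eq_mul]
  congr 2
  have : (Real.pi : ℂ) ≠ 0 := by exact_mod_cast Real.pi_ne_zero
  push_cast
  field_simp

/-- `P^t_{a,γ} f(x) = ∫ f̂(ξ) exp(i t |ξ|^a) exp(-t^γ |ξ|^a) exp(i x ξ) dξ`. -/
def P (a γ t : ℝ) (f : 𝓢(ℝ, ℂ)) (x : ℝ) : ℂ :=
  ∫ ξ : ℝ, fhat f ξ * Complex.exp (Complex.I * (t * |ξ| ^ a : ℝ))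
    * (Real.exp (-(t ^ γ * |ξ| ^ a)) : ℂ) * Complex.exp (Complex.I * (x * ξ : ℝ))

/-- The maximal function `P^*_{a,γ} f(x) = sup_{0 < t < 1} |P^t_{a,γ} f(x)|`, in `[0, ∞]`. -/
def maximalP (a γ : ℝ) (f : 𝓢(ℝ, ℂ)) (x : ℝ) : ℝ≥0∞ :=
  ⨆ t ∈ Ioo (0 : ℝ) 1, ‖P a γ t f x‖ₑ

/-- The inhomogeneous Sobolev norm `‖f‖_{H^s} = (∫ (1 + ξ²)^s |f̂(ξ)|² dξ)^{1/2}`. -/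
def sobolevNorm (s : ℝ) (f : 𝓢(ℝ, ℂ)) : ℝ≥0∞ :=
  eLpNorm (fun ξ : ℝ => (((1 + ξ ^ 2) ^ (s / 2) : ℝ) : ℂ) * fhat f ξ) 2 volume

/-- The local estimate `‖P^*_{a,γ} f‖_{L²([-1,1])} ≤ C ‖f‖_{H^s(ℝ)}`, with a finite constant `C`
independent of the Schwartz function `f`. -/
def LocalMaximalEstimate (a γ s : ℝ) : Prop :=
  ∃ C : ℝ≥0, ∀ f : 𝓢(ℝ, ℂ),
    eLpNorm (maximalP a γ f) 2 (volume.restrict (Icc (-1 : ℝ) 1)) ≤ C * sobolevNorm s f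

end ComplexTime

end

/-!
# Local maximal estimates for Schrödinger-type operators with complex time

*Sufficiency.* Along a measurable choice of times `t(x)`, the map `f ↦ P^{t(x)} f(x)` is a linear
operator `T`, and by `T T*` and Schur's test its norm from `H^s` to `L²([-1, 1])` is governed by the
kernel `∫ (1 + ξ²)^{-s} exp(-(t(x)^γ + t(y)^γ) |ξ|^a) exp(i (u ξ + t |ξ|^a)) dξ` with `u = x - y`
and `t = t(x) - t(y)`. On a dyadic block `|ξ| ∼ N` the amplitude is decreasing, so it only
contributes its initial value `N^{-2s} exp(-|t|^γ N^a)`. If `|u|` is much larger than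
`|t| N^{a-1}`, the phase has no stationary point and the block is `O(min(N, 1/|u|) N^{-2s})`.
Otherwise the second derivative of the phase is at least of size `|u| / N`, so the oscillatory
integral is `O((N/|u|)^{1/2})`; moreover `|t|` is at least of size `|u| N^{1-a}`, so the dissipation
gains any power of `(|u| N^{1-a+a/γ})^{-1}`. Choosing this power equal to zero when `s > 1/4`, and
close to `1/2` when `s > a (1 - 1/γ)⁺ / 4`, makes the blocks summable with total `O(|u|^{-β})` for
some `β < 1`, an integrable kernel (`exists_norm_block_le`, `exists_norm_kernel_le`,
`integral_norm_sq_le_of_kernel_le`, `localMaximalEstimate_of_lt`).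

*Necessity.* Put `α = min(a (1 - 1/γ), 1)`, assumed positive. A wave packet of frequency `N` and
frequency width `W ∼ N^{1-α/2}` travels with speed `a N^{a-1}`. Up to time `∼ N^{α-a}` it neither
disperses (the quadratic term of its phase is bounded) nor dissipates (as `α - a ≤ -a/γ`), so its
maximal function is at least of size `W` on an interval of length `∼ N^{α-1}`. Its Sobolev norm is
`∼ N^s W^{1/2}`. Comparing as `N → ∞` gives `s ≥ α/4` (`le_norm_P_of_bump`,
`le_of_localMaximalEstimate`).
-/

namespace ComplexTime

/-! ### Van der Corput estimates -/

/-- Integration against a monotone amplitude: if `g` has a primitive bounded by `M`, then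
`∫ g ψ` is controlled by `M` and the end-point values of `ψ`. -/
theorem norm_integral_mul_le_of_primitive_le {p q M : ℝ} (hpq : p ≤ q) {G g : ℝ → ℂ}
    {ψ ψ' : ℝ → ℝ} (hG : ∀ r ∈ Icc p q, HasDerivAt G (g r) r) (hg : ContinuousOn g (Icc p q))
    (hψ : ∀ r ∈ Icc p q, HasDerivAt ψ (ψ' r) r) (hψc : ContinuousOn ψ' (Icc p q))
    (hsign : (∀ r ∈ Icc p q, 0 ≤ ψ' r) ∨ ∀ r ∈ Icc p q, ψ' r ≤ 0)
    (hM : ∀ r ∈ Icc p q, ‖G r‖ ≤ M) :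
    ‖∫ r in p..q, g r * (ψ r : ℂ)‖ ≤ M * (|ψ q| + |ψ p| + |ψ q - ψ p|) := by
  have hu : uIcc p q = Icc p q := uIcc_of_le hpq
  have hp : p ∈ Icc p q := left_mem_Icc.2 hpq
  have hq : q ∈ Icc p q := right_mem_Icc.2 hpq
  have hM0 : 0 ≤ M := (norm_nonneg _).trans (hM p hp)
  have hψi : IntervalIntegrable ψ' volume p q := by
    apply ContinuousOn.intervalIntegrable; rwa [hu]
  have hψi' : IntervalIntegrable (fun r => (ψ' r : ℂ)) volume p q := by
    apply ContinuousOn.intervalIntegrable; rw [hu]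
    exact Complex.continuous_ofReal.comp_continuousOn hψc
  have hgi : IntervalIntegrable g volume p q := by
    apply ContinuousOn.intervalIntegrable; rwa [hu]
  have hparts : ∫ r in p..q, g r * (ψ r : ℂ) =
      G q * ψ q - G p * ψ p - ∫ r in p..q, G r * (ψ' r : ℂ) := by
    have := intervalIntegral.integral_mul_deriv_eq_deriv_mul (a := p) (b := q)
      (u := fun r => (ψ r : ℂ)) (v := G) (u' := fun r => (ψ' r : ℂ)) (v' := g)
      (by rw [hu]; exact fun r hr => (hψ r hr).ofReal_comp) (by rw [hu]; exact hG) hψi' hgi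
    simp only [mul_comm] at this ⊢
    exact this
  have htot : ∫ r in p..q, ψ' r = ψ q - ψ p :=
    intervalIntegral.integral_eq_sub_of_hasDerivAt (by rw [hu]; exact hψ) hψi
  have habs : ∫ r in p..q, |ψ' r| = |ψ q - ψ p| := by
    rcases hsign with h | h
    · rw [← htot, abs_of_nonneg (intervalIntegral.integral_nonneg hpq h)]
      exact intervalIntegral.integral_congr fun r hr => abs_of_nonneg (h r (hu ▸ hr))
    · have h1 : ∫ r in p..q, |ψ' r| = ∫ r in p..q, -ψ' r :=
        intervalIntegral.integral_congr fun r hr => abs_of_nonpos (h r (hu ▸ hr))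
      have h2 : 0 ≤ ∫ r in p..q, -ψ' r :=
        intervalIntegral.integral_nonneg hpq fun r hr => neg_nonneg.2 (h r hr)
      rw [intervalIntegral.integral_neg, htot] at h1 h2
      rw [h1, abs_of_nonpos (by linarith)]
  have hrest : ‖∫ r in p..q, G r * (ψ' r : ℂ)‖ ≤ M * |ψ q - ψ p| := by
    rw [← habs, ← intervalIntegral.integral_const_mul]
    refine intervalIntegral.norm_integral_le_of_norm_le hpq (ae_of_all _ fun r hr => ?_)
      (hψi.abs.const_mul M)
    rw [norm_mul, Complex.norm_real, Real.norm_eq_abs]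
    exact mul_le_mul_of_nonneg_right (hM r (Ioc_subset_Icc_self hr)) (abs_nonneg _)
  have e (r) (hr : r ∈ Icc p q) : ‖G r * (ψ r : ℂ)‖ ≤ M * |ψ r| := by
    rw [norm_mul, Complex.norm_real, Real.norm_eq_abs]
    exact mul_le_mul_of_nonneg_right (hM r hr) (abs_nonneg _)
  rw [hparts]
  calc _ ≤ ‖G q * ψ q‖ + ‖G p * ψ p‖ + ‖∫ r in p..q, G r * (ψ' r : ℂ)‖ :=
        (norm_sub_le _ _).trans (add_le_add_left (norm_sub_le _ _) _)
    _ ≤ M * |ψ q| + M * |ψ p| + M * |ψ q - ψ p| := by gcongr <;> [exact e q hq; exact e p hp]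
    _ = _ := by ring

/-- The first derivative test. -/
theorem norm_integral_exp_le_of_le_abs_deriv {p q l : ℝ} (hpq : p ≤ q) (hl : 0 < l)
    {φ φ' φ'' : ℝ → ℝ} (hφ : ∀ r ∈ Icc p q, HasDerivAt φ (φ' r) r)
    (hφ' : ∀ r ∈ Icc p q, HasDerivAt φ' (φ'' r) r) (hc : ContinuousOn φ'' (Icc p q))
    (hsign : (∀ r ∈ Icc p q, 0 ≤ φ'' r) ∨ ∀ r ∈ Icc p q, φ'' r ≤ 0)
    (hlow : ∀ r ∈ Icc p q, l ≤ |φ' r|) :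
    ‖∫ r in p..q, Complex.exp (Complex.I * (φ r : ℝ))‖ ≤ 4 / l := by
  have hne : ∀ r ∈ Icc p q, φ' r ≠ 0 := fun r hr h => by
    have := hlow r hr; rw [h, abs_zero] at this; linarith
  have hφc : ContinuousOn φ (Icc p q) := fun r hr => (hφ r hr).continuousAt.continuousWithinAt
  have hφ'c : ContinuousOn φ' (Icc p q) :=
    fun r hr => (hφ' r hr).continuousAt.continuousWithinAt
  have hcexp : ContinuousOn (fun r => Complex.exp (Complex.I * (φ r : ℝ))) (Icc p q) :=
    Complex.continuous_exp.comp_continuousOn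
      (continuousOn_const.mul (Complex.continuous_ofReal.comp_continuousOn hφc))
  have hinv : ∀ r ∈ Icc p q, |(φ' r)⁻¹| ≤ 1 / l := fun r hr => by
    rw [abs_inv, ← one_div]; exact one_div_le_one_div_of_le hl (hlow r hr)
  have key := norm_integral_mul_le_of_primitive_le (M := 1) hpq
    (G := fun r => -Complex.I * Complex.exp (Complex.I * (φ r : ℝ)))
    (g := fun r => Complex.exp (Complex.I * (φ r : ℝ)) * (φ' r : ℂ))
    (ψ := fun r => (φ' r)⁻¹) (ψ' := fun r => -φ'' r / φ' r ^ 2)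
    (fun r hr => by
      refine ((((hφ r hr).ofReal_comp.const_mul Complex.I).cexp).const_mul
        (-Complex.I)).congr_deriv ?_
      linear_combination (-Complex.exp (Complex.I * (φ r : ℝ)) * φ' r) * Complex.I_sq)
    (hcexp.mul (Complex.continuous_ofReal.comp_continuousOn hφ'c))
    (fun r hr => (hφ' r hr).fun_inv (hne r hr))
    ((hc.neg).div (hφ'c.pow 2) fun r hr => pow_ne_zero 2 (hne r hr))
    (by
      rcases hsign with h | h
      · right; intro r hr
        exact div_nonpos_of_nonpos_of_nonneg (neg_nonpos.2 (h r hr)) (sq_nonneg _)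
      · left; intro r hr
        exact div_nonneg (neg_nonneg.2 (h r hr)) (sq_nonneg _))
    (fun r hr => by
      rw [norm_mul, norm_neg, Complex.norm_I, one_mul, mul_comm Complex.I,
        Complex.norm_exp_ofReal_mul_I])
  -- Write the integrand as the derivative of `-i exp(i φ)` times the monotone amplitude `1 / φ'`.
  have hEq : ∫ r in p..q, Complex.exp (Complex.I * (φ r : ℝ)) =
      ∫ r in p..q, Complex.exp (Complex.I * (φ r : ℝ)) * (φ' r : ℂ) * ((φ' r)⁻¹ : ℝ) := by
    refine intervalIntegral.integral_congr fun r hr => ?_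
    rw [uIcc_of_le hpq] at hr
    have : (φ' r : ℂ) ≠ 0 := by exact_mod_cast hne r hr
    push_cast
    field_simp
  rw [hEq]
  refine key.trans ?_
  have h1 := hinv p (left_mem_Icc.2 hpq)
  have h2 := hinv q (right_mem_Icc.2 hpq)
  have h3 := abs_sub (φ' q)⁻¹ (φ' p)⁻¹
  have h4 : 4 / l = 4 * (1 / l) := by ring
  rw [h4]
  linarith

/-- A function with derivative at least `m` grows at least linearly away from some point. -/
theorem exists_mul_abs_sub_le {p q m : ℝ} (hpq : p ≤ q) {φ' φ'' : ℝ → ℝ}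
    (hφ' : ∀ r ∈ Icc p q, HasDerivAt φ' (φ'' r) r)
    (hlow : ∀ r ∈ Icc p q, m ≤ φ'' r) :
    ∃ z ∈ Icc p q, ∀ r ∈ Icc p q, m * |r - z| ≤ |φ' r| := by
  have hφ'c : ContinuousOn φ' (Icc p q) :=
    fun r hr => (hφ' r hr).continuousAt.continuousWithinAt
  have hp : p ∈ Icc p q := left_mem_Icc.2 hpq
  have hq : q ∈ Icc p q := right_mem_Icc.2 hpq
  have hinc : ∀ r₁ ∈ Icc p q, ∀ r₂ ∈ Icc p q, r₁ ≤ r₂ → m * (r₂ - r₁) ≤ φ' r₂ - φ' r₁ := by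
    refine (convex_Icc p q).mul_sub_le_image_sub_of_le_deriv hφ'c ?_ ?_
    · exact fun r hr => (hφ' r (interior_subset hr)).differentiableAt.differentiableWithinAt
    · intro r hr
      rw [(hφ' r (interior_subset hr)).deriv]
      exact hlow r (interior_subset hr)
  rcases le_total 0 (φ' p) with h | h
  · refine ⟨p, hp, fun r hr => ?_⟩
    have := hinc p hp r hr hr.1
    rw [abs_of_nonneg (by linarith [hr.1])]
    exact (by linarith : m * (r - p) ≤ φ' r).trans (le_abs_self _)
  rcases le_total (φ' q) 0 with h' | h'
  · refine ⟨q, hq, fun r hr => ?_⟩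
    have := hinc r hr q hq hr.2
    rw [abs_of_nonpos (by linarith [hr.2])]
    exact (by linarith : m * -(r - q) ≤ -φ' r).trans (neg_le_abs _)
  obtain ⟨z, hz, hz0⟩ := intermediate_value_Icc hpq hφ'c ⟨h, h'⟩
  refine ⟨z, hz, fun r hr => ?_⟩
  rcases le_total z r with hzr | hzr
  · have := hinc z hz r hr hzr
    rw [abs_of_nonneg (by linarith)]
    exact (by linarith : m * (r - z) ≤ φ' r).trans (le_abs_self _)
  · have := hinc r hr z hz hzr
    rw [abs_of_nonpos (by linarith)]
    exact (by linarith : m * -(r - z) ≤ -φ' r).trans (neg_le_abs _)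

/-- The second derivative test for a convex phase. The first derivative is at least `√m` outside
a window of length `2 / √m`, which is estimated trivially. -/
theorem norm_integral_exp_le_of_le_deriv2 {p q m : ℝ} (hpq : p ≤ q) (hm : 0 < m)
    {φ φ' φ'' : ℝ → ℝ} (hφ : ∀ r ∈ Icc p q, HasDerivAt φ (φ' r) r)
    (hφ' : ∀ r ∈ Icc p q, HasDerivAt φ' (φ'' r) r) (hc : ContinuousOn φ'' (Icc p q))
    (hlow : ∀ r ∈ Icc p q, m ≤ φ'' r) :
    ‖∫ r in p..q, Complex.exp (Complex.I * (φ r : ℝ))‖ ≤ 10 / √m := by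
  obtain ⟨z, hz, hzlow⟩ := exists_mul_abs_sub_le hpq hφ' hlow
  have hsm : 0 < √m := Real.sqrt_pos.2 hm
  -- The half-width `m ^ (-1/2)` balances the window around `z` against the first derivative test.
  set w : ℝ := 1 / √m with hw
  have hw0 : 0 < w := by positivity
  have hmw : m * w = √m := by
    rw [hw, mul_one_div, div_eq_iff hsm.ne', Real.mul_self_sqrt hm.le]
  have h4 : 4 / √m = 4 * w := by rw [hw]; ring
  set α := max p (z - w) with hα
  set β := min q (z + w) with hβ
  have hpα : p ≤ α := le_max_left _ _
  have hαz : α ≤ z := max_le hz.1 (by linarith)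
  have hzβ : z ≤ β := le_min hz.2 (by linarith)
  have hβq : β ≤ q := min_le_left _ _
  have hcexp : ContinuousOn (fun r => Complex.exp (Complex.I * (φ r : ℝ))) (Icc p q) :=
    Complex.continuous_exp.comp_continuousOn
      (continuousOn_const.mul (Complex.continuous_ofReal.comp_continuousOn
        fun r hr => (hφ r hr).continuousAt.continuousWithinAt))
  have hint : ∀ c d, p ≤ c → c ≤ d → d ≤ q →
      IntervalIntegrable (fun r => Complex.exp (Complex.I * (φ r : ℝ))) volume c d := by
    intro c d hc hcd hd
    apply ContinuousOn.intervalIntegrable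
    rw [uIcc_of_le hcd]
    exact hcexp.mono (Icc_subset_Icc hc hd)
  have hfirst : ∀ c d, p ≤ c → c ≤ d → d ≤ q → (∀ r ∈ Icc c d, w ≤ |r - z|) →
      ‖∫ r in c..d, Complex.exp (Complex.I * (φ r : ℝ))‖ ≤ 4 * w := by
    intro c d hc' hcd hd hfar
    have hsub : Icc c d ⊆ Icc p q := Icc_subset_Icc hc' hd
    rw [← h4]
    refine norm_integral_exp_le_of_le_abs_deriv hcd hsm (fun r hr => hφ r (hsub hr))
      (fun r hr => hφ' r (hsub hr)) (hc.mono hsub)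
      (Or.inl fun r hr => hm.le.trans (hlow r (hsub hr))) fun r hr => ?_
    rw [← hmw]
    exact (mul_le_mul_of_nonneg_left (hfar r hr) hm.le).trans (hzlow r (hsub hr))
  have h1 : ‖∫ r in p..α, Complex.exp (Complex.I * (φ r : ℝ))‖ ≤ 4 * w := by
    rcases le_total p (z - w) with h | h
    · have : α = z - w := max_eq_right h
      refine hfirst p α le_rfl hpα (by linarith) fun r hr => ?_
      rw [abs_of_nonpos (by linarith [hr.2])]
      linarith [hr.2]
    · have : α = p := max_eq_left h
      rw [this, intervalIntegral.integral_same, norm_zero]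
      positivity
  have h3 : ‖∫ r in β..q, Complex.exp (Complex.I * (φ r : ℝ))‖ ≤ 4 * w := by
    rcases le_total q (z + w) with h | h
    · have : β = q := min_eq_left h
      rw [this, intervalIntegral.integral_same, norm_zero]
      positivity
    · have : β = z + w := min_eq_right h
      refine hfirst β q (by linarith) hβq le_rfl fun r hr => ?_
      rw [abs_of_nonneg (by linarith [hr.1])]
      linarith [hr.1]
  have h2 : ‖∫ r in α..β, Complex.exp (Complex.I * (φ r : ℝ))‖ ≤ 2 * w := by
    have hb : ∀ r ∈ uIoc α β, ‖Complex.exp (Complex.I * (φ r : ℝ))‖ ≤ 1 := fun r _ => by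
      rw [mul_comm Complex.I, Complex.norm_exp_ofReal_mul_I]
    refine (intervalIntegral.norm_integral_le_of_norm_le_const hb).trans ?_
    rw [one_mul, abs_of_nonneg (by linarith)]
    have : z - w ≤ α := le_max_right _ _
    have : β ≤ z + w := min_le_right _ _
    linarith
  rw [← intervalIntegral.integral_add_adjacent_intervals (b := α)
      (hint p α le_rfl hpα (by linarith)) (hint α q hpα (by linarith) le_rfl),
    ← intervalIntegral.integral_add_adjacent_intervals (a := α) (b := β)
      (hint α β hpα (by linarith) hβq) (hint β q (by linarith) hβq le_rfl)]
  have h5 : 10 / √m = 10 * w := by rw [hw]; ring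
  rw [h5]
  refine (norm_add_le _ _).trans ?_
  have := norm_add_le (∫ r in α..β, Complex.exp (Complex.I * (φ r : ℝ)))
    (∫ r in β..q, Complex.exp (Complex.I * (φ r : ℝ)))
  linarith

theorem norm_integral_exp_neg (p q : ℝ) (φ : ℝ → ℝ) :
    ‖∫ r in p..q, Complex.exp (Complex.I * ((-φ r : ℝ) : ℂ))‖ =
      ‖∫ r in p..q, Complex.exp (Complex.I * (φ r : ℝ))‖ := by
  have : ∀ r, Complex.exp (Complex.I * ((-φ r : ℝ) : ℂ)) =
      Complex.conjCLE (Complex.exp (Complex.I * (φ r : ℝ))) := fun r => by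
    rw [Complex.conjCLE_apply, ← Complex.exp_conj]
    congr 1
    simp
  simp_rw [this]
  have h2 : ∫ r in p..q, Complex.conjCLE (Complex.exp (Complex.I * (φ r : ℝ))) =
      Complex.conjCLE (∫ r in p..q, Complex.exp (Complex.I * (φ r : ℝ))) := by
    simp only [intervalIntegral, map_sub]
    rw [ContinuousLinearEquiv.integral_comp_comm, ContinuousLinearEquiv.integral_comp_comm]
  rw [h2, Complex.conjCLE_apply, RCLike.norm_conj]

/-- The second derivative test. -/
theorem norm_integral_exp_le_of_le_abs_deriv2 {p q m : ℝ} (hpq : p ≤ q) (hm : 0 < m)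
    {φ φ' φ'' : ℝ → ℝ} (hφ : ∀ r ∈ Icc p q, HasDerivAt φ (φ' r) r)
    (hφ' : ∀ r ∈ Icc p q, HasDerivAt φ' (φ'' r) r) (hc : ContinuousOn φ'' (Icc p q))
    (hlow : (∀ r ∈ Icc p q, m ≤ φ'' r) ∨ ∀ r ∈ Icc p q, φ'' r ≤ -m) :
    ‖∫ r in p..q, Complex.exp (Complex.I * (φ r : ℝ))‖ ≤ 10 / √m := by
  rcases hlow with h | h
  · exact norm_integral_exp_le_of_le_deriv2 hpq hm hφ hφ' hc h
  · rw [← norm_integral_exp_neg]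
    exact norm_integral_exp_le_of_le_deriv2 (φ := fun r => -φ r) hpq hm
      (fun r hr => (hφ r hr).fun_neg) (fun r hr => (hφ' r hr).fun_neg) hc.neg
      fun r hr => le_neg_of_le_neg (h r hr)

/-- A decreasing nonnegative amplitude costs at most its initial value. -/
theorem norm_integral_exp_mul_le {p q M : ℝ} (hpq : p ≤ q) {φ ψ ψ' : ℝ → ℝ} (hφ : Continuous φ)
    (hψ : ∀ r ∈ Icc p q, HasDerivAt ψ (ψ' r) r) (hψc : ContinuousOn ψ' (Icc p q))
    (hψ' : ∀ r ∈ Icc p q, ψ' r ≤ 0) (hψ0 : ∀ r ∈ Icc p q, 0 ≤ ψ r)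
    (hM : ∀ r ∈ Icc p q, ‖∫ v in p..r, Complex.exp (Complex.I * (φ v : ℝ))‖ ≤ M) :
    ‖∫ r in p..q, Complex.exp (Complex.I * (φ r : ℝ)) * (ψ r : ℂ)‖ ≤ 2 * M * ψ p := by
  have hcexp : Continuous fun r => Complex.exp (Complex.I * (φ r : ℝ)) := by fun_prop
  have hp : p ∈ Icc p q := left_mem_Icc.2 hpq
  have hq : q ∈ Icc p q := right_mem_Icc.2 hpq
  have hM0 : 0 ≤ M := (norm_nonneg _).trans (hM p hp)
  have key := norm_integral_mul_le_of_primitive_le hpq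
    (G := fun r => ∫ v in p..r, Complex.exp (Complex.I * (φ v : ℝ)))
    (fun r _ => intervalIntegral.integral_hasDerivAt_right (hcexp.intervalIntegrable _ _)
      hcexp.stronglyMeasurable.stronglyMeasurableAtFilter hcexp.continuousAt)
    hcexp.continuousOn hψ hψc (Or.inr hψ') hM
  have hanti : ψ q ≤ ψ p := by
    refine (antitoneOn_of_deriv_nonpos (convex_Icc p q)
      (fun r hr => (hψ r hr).continuousAt.continuousWithinAt)
      (fun r hr => (hψ r (interior_subset hr)).differentiableAt.differentiableWithinAt)
      fun r hr => ?_) hp hq hpq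
    rw [(hψ r (interior_subset hr)).deriv]
    exact hψ' r (interior_subset hr)
  refine key.trans (le_of_eq ?_)
  rw [abs_of_nonneg (hψ0 q hq), abs_of_nonneg (hψ0 p hp), abs_of_nonpos (by linarith)]
  ring

/-! ### The kernel of the linearised operator composed with its adjoint -/

/-- The amplitude `(1 + r²)^{-s} exp(-c r^a)`: Sobolev weight times dissipation. -/
noncomputable def ampl (a s c r : ℝ) : ℝ := (1 + r ^ 2) ^ (-s) * Real.exp (-(c * r ^ a))

/-- The phase `u r + t r^a`. -/
noncomputable def phase (a u t r : ℝ) : ℝ := u * r + t * r ^ a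

theorem ampl_pos (a s c r : ℝ) : 0 < ampl a s c r := by unfold ampl; positivity

theorem hasDerivAt_phase {a : ℝ} (ha : 1 < a) (u t r : ℝ) :
    HasDerivAt (phase a u t) (u + t * (a * r ^ (a - 1))) r := by
  have h1 : HasDerivAt (fun r : ℝ => u * r) u r := by
    simpa using (hasDerivAt_id r).const_mul u
  exact h1.add ((Real.hasDerivAt_rpow_const (Or.inr ha.le)).const_mul t)

theorem hasDerivAt_phase_deriv (a u t : ℝ) {r : ℝ} (hr : 0 < r) :
    HasDerivAt (fun r => u + t * (a * r ^ (a - 1))) (t * (a * ((a - 1) * r ^ (a - 1 - 1)))) r :=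
  (((Real.hasDerivAt_rpow_const (Or.inl hr.ne')).const_mul a).const_mul t).const_add u

theorem continuous_phase {a : ℝ} (ha : 1 < a) (u t : ℝ) : Continuous (phase a u t) :=
  continuous_iff_continuousAt.2 fun r => (hasDerivAt_phase ha u t r).continuousAt

theorem hasDerivAt_ampl {a : ℝ} (ha : 1 < a) (s c r : ℝ) :
    HasDerivAt (ampl a s c)
      (2 * r * -s * (1 + r ^ 2) ^ (-s - 1) * Real.exp (-(c * r ^ a)) +
        (1 + r ^ 2) ^ (-s) * (Real.exp (-(c * r ^ a)) * -(c * (a * r ^ (a - 1))))) r := by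
  have h1 : HasDerivAt (fun r : ℝ => 1 + r ^ 2) (2 * r) r := by
    simpa using (hasDerivAt_pow 2 r).const_add 1
  have h2 := h1.rpow_const (p := -s) (Or.inl (by positivity))
  have h3 := (((Real.hasDerivAt_rpow_const (x := r) (p := a) (Or.inr ha.le)).const_mul c).fun_neg).exp
  exact h2.mul h3

theorem continuous_ampl {a : ℝ} (ha : 1 < a) (s c : ℝ) : Continuous (ampl a s c) :=
  continuous_iff_continuousAt.2 fun r => (hasDerivAt_ampl ha s c r).continuousAt

theorem ampl_le_exp {s : ℝ} (hs : 0 ≤ s) (a c r : ℝ) :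
    ampl a s c r ≤ Real.exp (-(c * r ^ a)) := by
  unfold ampl
  have : (1 + r ^ 2) ^ (-s) ≤ 1 :=
    Real.rpow_le_one_of_one_le_of_nonpos (by nlinarith [sq_nonneg r]) (by linarith)
  nlinarith [Real.exp_pos (-(c * r ^ a))]

theorem ampl_le_rpow {s N : ℝ} (hs : 0 ≤ s) (hN : 1 ≤ N) (a c : ℝ) :
    ampl a s c N ≤ N ^ (-(2 * s)) * Real.exp (-(c * N ^ a)) := by
  unfold ampl
  refine mul_le_mul_of_nonneg_right ?_ (Real.exp_pos _).le
  rw [show -(2 * s) = ((2 : ℕ) : ℝ) * (-s) by push_cast; ring, Real.rpow_mul (by linarith),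
    Real.rpow_natCast]
  exact Real.rpow_le_rpow_of_nonpos (by positivity) (by linarith) (by linarith)

/-- Away from the stationary point: bound by the length and by the first derivative test,
interpolated. -/
theorem norm_integral_exp_phase_le_of_large {a β N u t q : ℝ} (ha : 1 < a) (hβ0 : 0 ≤ β)
    (hβ1 : β ≤ 1) (hN : 0 < N) (hu : u ≠ 0) (hut : 2 * (|t| * (a * (2 * N) ^ (a - 1))) ≤ |u|)
    (hq : q ∈ Icc N (2 * N)) :
    ‖∫ r in N..q, Complex.exp (Complex.I * (phase a u t r : ℝ))‖ ≤
      8 * N ^ (1 - β) * |u| ^ (-β) := by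
  have hu0 : 0 < |u| := abs_pos.2 hu
  have hsub : Icc N q ⊆ Icc N (2 * N) := Icc_subset_Icc_right hq.2
  have hpos : ∀ r ∈ Icc N q, 0 < r := fun r hr => hN.trans_le hr.1
  set x := ‖∫ r in N..q, Complex.exp (Complex.I * (phase a u t r : ℝ))‖
  have hx0 : 0 ≤ x := norm_nonneg _
  have h1 : x ≤ N := by
    have hb : ∀ r ∈ uIoc N q, ‖Complex.exp (Complex.I * (phase a u t r : ℝ))‖ ≤ 1 := fun r _ => by
      rw [mul_comm Complex.I, Complex.norm_exp_ofReal_mul_I]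
    refine (intervalIntegral.norm_integral_le_of_norm_le_const hb).trans ?_
    rw [one_mul, abs_of_nonneg (by linarith [hq.1])]
    linarith [hq.2]
  have h2 : x ≤ 8 / |u| := by
    have : 8 / |u| = 4 / (|u| / 2) := by field_simp; norm_num
    rw [this]
    refine norm_integral_exp_le_of_le_abs_deriv hq.1 (by positivity)
      (fun r _ => hasDerivAt_phase ha u t r)
      (fun r hr => hasDerivAt_phase_deriv a u t (hpos r hr)) ?_ ?_ fun r hr => ?_
    · refine continuousOn_const.mul (continuousOn_const.mul (continuousOn_const.mul ?_))
      exact ContinuousOn.rpow_const continuousOn_id fun r hr => Or.inl (hpos r hr).ne'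
    · have h : ∀ r ∈ Icc N q, 0 ≤ a * ((a - 1) * r ^ (a - 1 - 1)) := fun r hr =>
        mul_nonneg (by linarith) (mul_nonneg (by linarith) (Real.rpow_nonneg (hpos r hr).le _))
      rcases le_total 0 t with ht | ht
      · exact Or.inl fun r hr => mul_nonneg ht (h r hr)
      · exact Or.inr fun r hr => mul_nonpos_of_nonpos_of_nonneg ht (h r hr)
    · have h3 : r ^ (a - 1) ≤ (2 * N) ^ (a - 1) :=
        Real.rpow_le_rpow (hpos r hr).le (hsub hr).2 (by linarith)
      have h4 : |t * (a * r ^ (a - 1))| ≤ |t| * (a * (2 * N) ^ (a - 1)) := by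
        rw [abs_mul, abs_of_nonneg (a := a * r ^ (a - 1))
          (mul_nonneg (by linarith) (Real.rpow_nonneg (hpos r hr).le _))]
        gcongr
      have h5 := abs_sub_abs_le_abs_sub u (-(t * (a * r ^ (a - 1))))
      rw [abs_neg, sub_neg_eq_add] at h5
      linarith
  calc x = x ^ (1 - β) * x ^ β := by
        rw [← Real.rpow_add_of_nonneg hx0 (by linarith) hβ0]; simp
    _ ≤ N ^ (1 - β) * (8 / |u|) ^ β := by gcongr
    _ = 8 ^ β * N ^ (1 - β) * |u| ^ (-β) := by
        rw [Real.div_rpow (by norm_num) hu0.le, Real.rpow_neg hu0.le]; ring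
    _ ≤ 8 * N ^ (1 - β) * |u| ^ (-β) := by
        gcongr
        exact (Real.rpow_le_rpow_of_exponent_le (by norm_num) hβ1).trans (by simp)

/-- Near the stationary point the second derivative of the phase is at least of size `|u| / N`. -/
theorem norm_integral_exp_phase_le_of_small {a N u t q : ℝ} (ha : 1 < a) (hN : 0 < N)
    (hu : u ≠ 0) (hut : |u| ≤ a * 2 ^ a * |t| * N ^ (a - 1)) (hq : q ∈ Icc N (2 * N)) :
    ‖∫ r in N..q, Complex.exp (Complex.I * (phase a u t r : ℝ))‖ ≤
      10 / √((a - 1) / 2 ^ (a + 1) * (|u| / N)) := by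
  have hu0 : 0 < |u| := abs_pos.2 hu
  have ha1 : 0 < a - 1 := by linarith
  have hpos : ∀ r ∈ Icc N q, 0 < r := fun r hr => hN.trans_le hr.1
  have h2 : (2 : ℝ) ^ (a + 1) = 2 * 2 ^ a := by
    rw [Real.rpow_add (by norm_num), Real.rpow_one]; ring
  have h2a : (0 : ℝ) < 2 ^ a := by positivity
  have hlow : ∀ r ∈ Icc N q,
      (a - 1) / 2 ^ (a + 1) * (|u| / N) ≤ |t| * (a * ((a - 1) * r ^ (a - 1 - 1))) := by
    intro r hr
    have hr0 := hpos r hr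
    -- Split off one factor `r`, so that no case distinction on the sign of `a - 2` is needed.
    have e1 : N ^ (a - 1) / (2 * N) ≤ r ^ (a - 1 - 1) := by
      rw [Real.rpow_sub_one hr0.ne']
      gcongr
      · exact hr.1
      · linarith [hr.2, hq.2]
    calc (a - 1) / 2 ^ (a + 1) * (|u| / N)
        ≤ (a - 1) / 2 ^ (a + 1) * ((a * 2 ^ a * |t| * N ^ (a - 1)) / N) := by gcongr
      _ = |t| * (a * ((a - 1) * (N ^ (a - 1) / (2 * N)))) := by rw [h2]; field_simp
      _ ≤ _ := by gcongr
  refine norm_integral_exp_le_of_le_abs_deriv2 hq.1 (by positivity)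
    (fun r _ => hasDerivAt_phase ha u t r)
    (fun r hr => hasDerivAt_phase_deriv a u t (hpos r hr)) ?_ ?_
  · refine continuousOn_const.mul (continuousOn_const.mul (continuousOn_const.mul ?_))
    exact ContinuousOn.rpow_const continuousOn_id fun r hr => Or.inl (hpos r hr).ne'
  · rcases le_total 0 t with ht | ht
    · left; intro r hr
      simpa [abs_of_nonneg ht] using hlow r hr
    · right; intro r hr
      have := hlow r hr
      rw [abs_of_nonpos ht] at this
      linarith

/-- Exponential damping beats any power, with a constant uniform on `(0, ∞)`. -/
theorem exists_exp_neg_rpow_le {γ p : ℝ} (hγ : 0 < γ) (hp : 0 ≤ p) :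
    ∃ D : ℝ, 0 < D ∧ ∀ y : ℝ, 0 < y → Real.exp (-(y ^ γ)) ≤ D * y ^ (-p) := by
  obtain ⟨n, hn⟩ := exists_nat_ge (p / γ)
  refine ⟨1 + n.factorial, by positivity, fun y hy => ?_⟩
  have hz : 0 < y ^ γ := by positivity
  have h1 : y ^ p ≤ (1 + n.factorial) * Real.exp (y ^ γ) := by
    have e : y ^ p = (y ^ γ) ^ (p / γ) := by
      rw [← Real.rpow_mul hy.le]; congr 1; field_simp
    have e1 : 1 ≤ Real.exp (y ^ γ) := Real.one_le_exp hz.le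
    have e2 : (y ^ γ) ^ n ≤ n.factorial * Real.exp (y ^ γ) := by
      have := Real.pow_div_factorial_le_exp (y ^ γ) hz.le n
      rw [div_le_iff₀ (by positivity)] at this
      linarith
    rw [e]
    rcases le_total (y ^ γ) 1 with h | h
    · have : (y ^ γ) ^ (p / γ) ≤ 1 := Real.rpow_le_one hz.le h (by positivity)
      nlinarith [Real.exp_pos (y ^ γ), (Nat.cast_nonneg n.factorial : (0 : ℝ) ≤ _)]
    · have : (y ^ γ) ^ (p / γ) ≤ (y ^ γ) ^ n := by
        rw [← Real.rpow_natCast]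
        exact Real.rpow_le_rpow_of_exponent_le h hn
      nlinarith [Real.exp_pos (y ^ γ)]
  rw [Real.rpow_neg hy.le, Real.exp_neg, ← div_eq_mul_inv, inv_eq_one_div,
    div_le_div_iff₀ (Real.exp_pos _) (by positivity)]
  linarith

/-- The dyadic block of the kernel. In the stationary regime `|t|` is at least of size
`|u| N^{1-a}`, so the dissipation `exp(-|t|^γ N^a)` gains a power of `|u| N^{1-a+a/γ}`. -/
theorem exists_norm_block_le {a γ s β ρ : ℝ} (ha : 1 < a) (hγ : 0 < γ) (hs : 0 ≤ s)
    (hβ0 : 1 / 2 ≤ β) (hβ1 : β ≤ 1) (hρ1 : 1 - β - 2 * s ≤ -ρ)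
    (hρ2 : 1 / 2 - 2 * s - (β - 1 / 2) * (1 - a + a / γ) ≤ -ρ) :
    ∃ C : ℝ, 0 ≤ C ∧ ∀ N u t c : ℝ, 1 ≤ N → u ≠ 0 → |t| ^ γ ≤ c →
      ‖∫ r in N..(2 * N), Complex.exp (Complex.I * (phase a u t r : ℝ)) * (ampl a s c r : ℂ)‖ ≤
        C * N ^ (-ρ) * |u| ^ (-β) := by
  obtain ⟨D, hD0, hD⟩ := exists_exp_neg_rpow_le hγ (show 0 ≤ β - 1 / 2 by linarith)
  have ha1 : 0 < a - 1 := by linarith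
  set κ : ℝ := (a - 1) / 2 ^ (a + 1) with hκ
  have hκ0 : 0 < κ := by positivity
  set A : ℝ := a * 2 ^ a with hA
  have hA0 : 0 < A := by positivity
  refine ⟨16 + 20 / √κ * D * A ^ (β - 1 / 2), by positivity, fun N u t c hN hu htc => ?_⟩
  have hN0 : 0 < N := by linarith
  have hu0 : 0 < |u| := abs_pos.2 hu
  have hc0 : 0 ≤ c := (by positivity : 0 ≤ |t| ^ γ).trans htc
  have hamp : ∀ M : ℝ, (∀ q ∈ Icc N (2 * N),
      ‖∫ r in N..q, Complex.exp (Complex.I * (phase a u t r : ℝ))‖ ≤ M) →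
      ‖∫ r in N..(2 * N), Complex.exp (Complex.I * (phase a u t r : ℝ)) * (ampl a s c r : ℂ)‖ ≤
        2 * M * (N ^ (-(2 * s)) * Real.exp (-(c * N ^ a))) := by
    intro M hM
    have hM0 : 0 ≤ M := (norm_nonneg _).trans (hM N ⟨le_rfl, by linarith⟩)
    refine (norm_integral_exp_mul_le (by linarith) (continuous_phase ha u t)
      (fun r _ => hasDerivAt_ampl ha s c r) ?_ ?_ (fun r _ => (ampl_pos a s c r).le) hM).trans ?_
    · have hne : ∀ r : ℝ, 1 + r ^ 2 ≠ 0 := fun r => by positivity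
      have c1 : Continuous fun r : ℝ => (1 + r ^ 2) ^ (-s - 1) :=
        Continuous.rpow_const (by fun_prop) fun r => Or.inl (hne r)
      have c2 : Continuous fun r : ℝ => (1 + r ^ 2) ^ (-s) :=
        Continuous.rpow_const (by fun_prop) fun r => Or.inl (hne r)
      have c3 : Continuous fun r : ℝ => r ^ a :=
        Continuous.rpow_const continuous_id fun r => Or.inr (by linarith)
      have c4 : Continuous fun r : ℝ => r ^ (a - 1) :=
        Continuous.rpow_const continuous_id fun r => Or.inr (by linarith)
      apply Continuous.continuousOn
      fun_prop
    · intro r hr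
      have hr0 : 0 < r := hN0.trans_le hr.1
      have e1 : 0 ≤ r * s * (1 + r ^ 2) ^ (-s - 1) * Real.exp (-(c * r ^ a)) := by positivity
      have e2 : 0 ≤ (1 + r ^ 2) ^ (-s) * (Real.exp (-(c * r ^ a)) * (c * (a * r ^ (a - 1)))) := by
        positivity
      linarith
    · gcongr
      exact ampl_le_rpow hs hN a c
  have hexp1 : Real.exp (-(c * N ^ a)) ≤ 1 := Real.exp_le_one_iff.2 (by
    have : 0 ≤ c * N ^ a := by positivity
    linarith)
  rcases le_or_gt (2 * (|t| * (a * (2 * N) ^ (a - 1)))) |u| with hut | hut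
  · refine (hamp _ fun q hq => norm_integral_exp_phase_le_of_large ha (by linarith) hβ1 hN0 hu
      hut hq).trans ?_
    calc 2 * (8 * N ^ (1 - β) * |u| ^ (-β)) * (N ^ (-(2 * s)) * Real.exp (-(c * N ^ a)))
        ≤ 2 * (8 * N ^ (1 - β) * |u| ^ (-β)) * (N ^ (-(2 * s)) * 1) := by gcongr
      _ = 16 * N ^ (1 - β - 2 * s) * |u| ^ (-β) := by
          rw [show 1 - β - 2 * s = (1 - β) + -(2 * s) by ring, Real.rpow_add hN0]; ring
      _ ≤ 16 * N ^ (-ρ) * |u| ^ (-β) := by gcongr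
      _ ≤ _ := by
          gcongr
          have : 0 ≤ 20 / √κ * D * A ^ (β - 1 / 2) := by positivity
          linarith
  · have hut' : |u| ≤ A * |t| * N ^ (a - 1) := by
      refine hut.le.trans (le_of_eq ?_)
      have : (2 : ℝ) ^ a = 2 * 2 ^ (a - 1) := by
        rw [Real.rpow_sub_one (by norm_num)]; ring
      rw [Real.mul_rpow (by norm_num) hN0.le, hA, this]
      ring
    have ht0 : 0 < |t| := by
      by_contra h
      have : |t| = 0 := le_antisymm (not_lt.1 h) (abs_nonneg t)
      rw [this] at hut'
      simp only [mul_zero, zero_mul] at hut'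
      linarith
    refine (hamp _ fun q hq => norm_integral_exp_phase_le_of_small ha hN0 hu hut' hq).trans ?_
    have hdamp : Real.exp (-(c * N ^ a)) ≤
        D * (A ^ (β - 1 / 2) * |u| ^ (-(β - 1 / 2)) * N ^ (-((β - 1 / 2) * (1 - a + a / γ)))) := by
      have y1 : |u| * N ^ (1 - a + a / γ) / A ≤ |t| * N ^ (a / γ) := by
        rw [div_le_iff₀ hA0]
        calc |u| * N ^ (1 - a + a / γ) ≤ (A * |t| * N ^ (a - 1)) * N ^ (1 - a + a / γ) := by gcongr
          _ = A * |t| * (N ^ (a - 1) * N ^ (1 - a + a / γ)) := by ring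
          _ = |t| * N ^ (a / γ) * A := by
              rw [← Real.rpow_add hN0, show a - 1 + (1 - a + a / γ) = a / γ by ring]; ring
      have y0 : 0 < |u| * N ^ (1 - a + a / γ) / A := by positivity
      have e : |t| ^ γ * N ^ a = (|t| * N ^ (a / γ)) ^ γ := by
        rw [Real.mul_rpow ht0.le (by positivity), ← Real.rpow_mul hN0.le, div_mul_cancel₀ _ hγ.ne']
      calc Real.exp (-(c * N ^ a)) ≤ Real.exp (-(|t| ^ γ * N ^ a)) := by gcongr
        _ = Real.exp (-((|t| * N ^ (a / γ)) ^ γ)) := by rw [e]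
        _ ≤ D * (|t| * N ^ (a / γ)) ^ (-(β - 1 / 2)) := hD _ (by positivity)
        _ ≤ D * (|u| * N ^ (1 - a + a / γ) / A) ^ (-(β - 1 / 2)) := by
            gcongr ?_ * ?_
            exact Real.rpow_le_rpow_of_nonpos y0 y1 (by linarith)
        _ = _ := by
            rw [Real.div_rpow (by positivity) hA0.le, Real.mul_rpow hu0.le (by positivity),
              ← Real.rpow_mul hN0.le, Real.rpow_neg hA0.le, div_inv_eq_mul]
            ring_nf
    have hsq : 10 / √(κ * (|u| / N)) = 10 / √κ * (N ^ (1 / 2 : ℝ) * |u| ^ (-(1 / 2) : ℝ)) := by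
      rw [Real.sqrt_mul hκ0.le, Real.sqrt_div hu0.le, Real.sqrt_eq_rpow |u|, Real.sqrt_eq_rpow N,
        Real.rpow_neg hu0.le]
      have := Real.rpow_pos_of_pos hu0 (1 / 2)
      field_simp
    rw [hsq]
    calc 2 * (10 / √κ * (N ^ (1 / 2 : ℝ) * |u| ^ (-(1 / 2) : ℝ))) *
          (N ^ (-(2 * s)) * Real.exp (-(c * N ^ a)))
        ≤ 2 * (10 / √κ * (N ^ (1 / 2 : ℝ) * |u| ^ (-(1 / 2) : ℝ))) * (N ^ (-(2 * s)) *
          (D * (A ^ (β - 1 / 2) * |u| ^ (-(β - 1 / 2)) *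
            N ^ (-((β - 1 / 2) * (1 - a + a / γ)))))) := by gcongr
      _ = 20 / √κ * D * A ^ (β - 1 / 2) *
          (N ^ (1 / 2 : ℝ) * N ^ (-(2 * s)) * N ^ (-((β - 1 / 2) * (1 - a + a / γ)))) *
          (|u| ^ (-(1 / 2) : ℝ) * |u| ^ (-(β - 1 / 2))) := by ring
      _ = 20 / √κ * D * A ^ (β - 1 / 2) *
          N ^ (1 / 2 - 2 * s - (β - 1 / 2) * (1 - a + a / γ)) * |u| ^ (-β) := by
          rw [← Real.rpow_add hN0, ← Real.rpow_add hN0, ← Real.rpow_add hu0]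
          ring_nf
      _ ≤ 20 / √κ * D * A ^ (β - 1 / 2) * N ^ (-ρ) * |u| ^ (-β) := by gcongr
      _ ≤ _ := by gcongr; linarith

theorem integrableOn_ampl {a s c : ℝ} (ha : 1 < a) (hs : 0 ≤ s) (hc : 0 < c) :
    IntegrableOn (ampl a s c) (Ioi 0) := by
  have h := integrableOn_rpow_mul_exp_neg_mul_rpow (p := a) (s := 0) (b := c) (by norm_num)
    (by linarith) hc
  refine Integrable.mono' h (continuous_ampl ha s c).aestronglyMeasurable (ae_of_all _ fun r => ?_)
  rw [Real.norm_of_nonneg (ampl_pos a s c r).le, Real.rpow_zero, one_mul, neg_mul]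
  exact ampl_le_exp hs a c r

theorem integrableOn_exp_phase_mul_ampl {a s c : ℝ} (ha : 1 < a) (hs : 0 ≤ s) (hc : 0 < c)
    (u t : ℝ) : IntegrableOn
      (fun r => Complex.exp (Complex.I * (phase a u t r : ℝ)) * (ampl a s c r : ℂ)) (Ioi 0) := by
  have h1 := continuous_phase ha u t
  have h2 := continuous_ampl ha s c
  refine Integrable.mono' (integrableOn_ampl ha hs hc)
    (Continuous.aestronglyMeasurable (by fun_prop)) (ae_of_all _ fun r => ?_)
  rw [norm_mul, mul_comm Complex.I, Complex.norm_exp_ofReal_mul_I, one_mul, Complex.norm_real,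
    Real.norm_of_nonneg (ampl_pos a s c r).le]

/-- Summing the dyadic blocks gives the half-line kernel. -/
theorem exists_norm_integral_Ioi_le {a γ s β ρ : ℝ} (ha : 1 < a) (hγ : 0 < γ) (hs : 0 ≤ s)
    (hβ0 : 1 / 2 ≤ β) (hβ1 : β ≤ 1) (hρ : 0 < ρ) (hρ1 : 1 - β - 2 * s ≤ -ρ)
    (hρ2 : 1 / 2 - 2 * s - (β - 1 / 2) * (1 - a + a / γ) ≤ -ρ) :
    ∃ C : ℝ, 0 ≤ C ∧ ∀ u t c : ℝ, u ≠ 0 → 0 < c → |t| ^ γ ≤ c →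
      ‖∫ r in Ioi (0 : ℝ), Complex.exp (Complex.I * (phase a u t r : ℝ)) * (ampl a s c r : ℂ)‖ ≤
        1 + C * |u| ^ (-β) := by
  obtain ⟨C, hC0, hC⟩ := exists_norm_block_le ha hγ hs hβ0 hβ1 hρ1 hρ2
  have hr1 : (2 : ℝ) ^ (-ρ) < 1 := Real.rpow_lt_one_of_one_lt_of_neg (by norm_num) (by linarith)
  have hr0 : (0 : ℝ) < 2 ^ (-ρ) := by positivity
  refine ⟨C * (1 - 2 ^ (-ρ))⁻¹, mul_nonneg hC0 (inv_nonneg.2 (by linarith)),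
    fun u t c hu hc htc => ?_⟩
  set F : ℝ → ℂ := fun r =>
    Complex.exp (Complex.I * (phase a u t r : ℝ)) * (ampl a s c r : ℂ) with hF
  have hFi : IntegrableOn F (Ioi 0) := integrableOn_exp_phase_mul_ampl ha hs hc u t
  have hFc : Continuous F := by
    have h1 := continuous_phase ha u t
    have h2 := continuous_ampl ha s c
    fun_prop
  have hlim := intervalIntegral_tendsto_integral_Ioi 0 hFi
    (tendsto_pow_atTop_atTop_of_one_lt (one_lt_two (α := ℝ)))
  refine le_of_tendsto hlim.norm (Filter.Eventually.of_forall fun n => ?_)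
  rw [← intervalIntegral.integral_add_adjacent_intervals (b := 1)
    (hFc.intervalIntegrable _ _) (hFc.intervalIntegrable _ _)]
  have h01 : ‖∫ r in (0 : ℝ)..1, F r‖ ≤ 1 := by
    have hb : ∀ r ∈ uIoc (0 : ℝ) 1, ‖F r‖ ≤ 1 := fun r hr => by
      rw [uIoc_of_le zero_le_one] at hr
      rw [hF, norm_mul, mul_comm Complex.I, Complex.norm_exp_ofReal_mul_I, one_mul,
        Complex.norm_real, Real.norm_of_nonneg (ampl_pos a s c r).le]
      refine (ampl_le_exp hs a c r).trans (Real.exp_le_one_iff.2 ?_)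
      have := hr.1
      have : 0 ≤ c * r ^ a := by positivity
      linarith
    simpa using intervalIntegral.norm_integral_le_of_norm_le_const hb
  have hsum : ‖∫ r in (1 : ℝ)..2 ^ n, F r‖ ≤ C * (1 - 2 ^ (-ρ))⁻¹ * |u| ^ (-β) := by
    have := intervalIntegral.sum_integral_adjacent_intervals (f := F) (μ := volume)
      (a := fun k : ℕ => (2 : ℝ) ^ k) (n := n) fun k _ => hFc.intervalIntegrable _ _
    rw [pow_zero] at this
    rw [← this]
    refine (norm_sum_le _ _).trans ?_
    calc ∑ k ∈ Finset.range n, ‖∫ r in (2 : ℝ) ^ k..2 ^ (k + 1), F r‖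
        ≤ ∑ k ∈ Finset.range n, C * |u| ^ (-β) * (2 ^ (-ρ)) ^ k := by
          refine Finset.sum_le_sum fun k _ => ?_
          have := hC (2 ^ k) u t c (one_le_pow₀ (by norm_num)) hu htc
          rw [pow_succ']
          refine this.trans (le_of_eq ?_)
          rw [← Real.rpow_natCast, ← Real.rpow_natCast, ← Real.rpow_mul (by norm_num),
            ← Real.rpow_mul (by norm_num)]
          ring_nf
      _ = C * |u| ^ (-β) * ∑ k ∈ Finset.range n, (2 ^ (-ρ)) ^ k := by rw [Finset.mul_sum]
      _ ≤ C * |u| ^ (-β) * (1 - 2 ^ (-ρ))⁻¹ := by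
          gcongr
          rw [← tsum_geometric_of_lt_one hr0.le hr1]
          exact (summable_geometric_of_lt_one hr0.le hr1).sum_le_tsum _
            fun k _ => by positivity
      _ = _ := by ring
  exact (norm_add_le _ _).trans (add_le_add h01 hsum)

/-- The kernel on the line is `O(|u| ^ (-β))` for `|u| ≤ 2`, uniformly in the times. -/
theorem exists_norm_kernel_le {a γ s β ρ : ℝ} (ha : 1 < a) (hγ : 0 < γ) (hs : 0 ≤ s)
    (hβ0 : 1 / 2 ≤ β) (hβ1 : β ≤ 1) (hρ : 0 < ρ) (hρ1 : 1 - β - 2 * s ≤ -ρ)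
    (hρ2 : 1 / 2 - 2 * s - (β - 1 / 2) * (1 - a + a / γ) ≤ -ρ) :
    ∃ C : ℝ, 0 ≤ C ∧ ∀ u t c : ℝ, u ≠ 0 → |u| ≤ 2 → 0 < c → |t| ^ γ ≤ c →
      ‖∫ ξ : ℝ, Complex.exp (Complex.I * ((u * ξ + t * |ξ| ^ a : ℝ) : ℂ)) *
        (ampl a s c |ξ| : ℂ)‖ ≤ C * |u| ^ (-β) := by
  obtain ⟨C, hC0, hC⟩ := exists_norm_integral_Ioi_le ha hγ hs hβ0 hβ1 hρ hρ1 hρ2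
  refine ⟨4 + 2 * C, by positivity, fun u t c hu hu2 hc htc => ?_⟩
  set F : ℝ → ℂ := fun ξ => Complex.exp (Complex.I * ((u * ξ + t * |ξ| ^ a : ℝ) : ℂ)) *
        (ampl a s c |ξ| : ℂ) with hF
  have hu0 : 0 < |u| := abs_pos.2 hu
  have hpos : EqOn F (fun r => Complex.exp (Complex.I * (phase a u t r : ℝ)) *
      (ampl a s c r : ℂ)) (Ioi 0) := fun r hr => by
    simp only [hF, phase, abs_of_pos (show (0 : ℝ) < r from hr)]
  have hneg : EqOn (fun r => F (-r)) (fun r => Complex.exp (Complex.I * (phase a (-u) t r : ℝ)) *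
      (ampl a s c r : ℂ)) (Ioi 0) := fun r hr => by
    simp only [hF, phase, abs_neg, abs_of_pos (show (0 : ℝ) < r from hr), mul_neg, neg_mul]
  clear_value F
  have hi1 : IntegrableOn F (Ioi 0) :=
    (integrableOn_exp_phase_mul_ampl ha hs hc u t).congr_fun hpos.symm measurableSet_Ioi
  have hi2 : IntegrableOn F (Iic 0) := by
    have : IntegrableOn (fun r => F (-r)) (Ioi 0) :=
      (integrableOn_exp_phase_mul_ampl ha hs hc (-u) t).congr_fun hneg.symm measurableSet_Ioi
    rw [integrableOn_Iic_iff_integrableOn_Iio]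
    rw [← neg_zero] at this
    simpa only [neg_neg] using this.comp_neg_Iio
  have hsplit : ∫ ξ, F ξ = (∫ ξ in Iic 0, F ξ) + ∫ ξ in Ioi 0, F ξ := by
    exact (intervalIntegral.integral_Iic_add_Ioi hi2 hi1).symm
  have hflip : ∫ ξ in Iic 0, F ξ = ∫ r in Ioi 0, F (-r) := by
    rw [integral_comp_neg_Ioi, neg_zero]
  have k1 : ‖∫ ξ in Ioi 0, F ξ‖ ≤ 1 + C * |u| ^ (-β) := by
    rw [setIntegral_congr_fun measurableSet_Ioi hpos]
    exact hC u t c hu hc htc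
  have k2 : ‖∫ ξ in Iic 0, F ξ‖ ≤ 1 + C * |u| ^ (-β) := by
    rw [hflip, setIntegral_congr_fun measurableSet_Ioi hneg, ← abs_neg u]
    exact hC (-u) t c (neg_ne_zero.2 hu) hc htc
  have k3 : 1 ≤ 2 * |u| ^ (-β) := by
    have e1 : (2 : ℝ) ^ (-β) ≤ |u| ^ (-β) := Real.rpow_le_rpow_of_nonpos hu0 hu2 (by linarith)
    have e2 : (2 : ℝ) ^ (-1 : ℝ) ≤ 2 ^ (-β) :=
      Real.rpow_le_rpow_of_exponent_le (by norm_num) (by linarith)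
    rw [Real.rpow_neg_one] at e2
    linarith
  rw [hsplit]
  refine (norm_add_le _ _).trans ?_
  nlinarith

/-! ### The `T T*` argument -/

open ComplexConjugate in
/-- An oscillatory operator `T g x = ∫ g m(x, ·)` is bounded from `L²(w)` to `L²(μ)` with norm
squared at most `A`, if the kernel `∫ w⁻¹ m(x, ·) conj m(y, ·)` of `T T*` is dominated by a
convolution kernel of integral at most `A`. -/
theorem integral_norm_sq_le_of_kernel_le {μ : Measure ℝ} [IsFiniteMeasure μ]
    (hμ : μ ≤ volume) {m : ℝ → ℝ → ℂ} {w : ℝ → ℝ} {g : ℝ → ℂ} {Φ k : ℝ → ℝ} {A : ℝ}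
    (hA : 0 < A) (hm : Measurable (Function.uncurry m)) (hm1 : ∀ x ξ, ‖m x ξ‖ ≤ 1)
    (hw : Measurable w) (hw0 : ∀ ξ, 0 < w ξ) (hg : Integrable g) (hgm : Measurable g)
    (hgw : Integrable fun ξ => w ξ * ‖g ξ‖ ^ 2)
    (hΦ : Integrable Φ) (hmΦ : ∀ x ξ, (w ξ)⁻¹ * ‖m x ξ‖ ≤ Φ ξ)
    (hk : Integrable k) (hkm : Measurable k) (hk0 : ∀ u, 0 ≤ k u) (hkA : ∫ u, k u ≤ A)
    (hker : ∀ᵐ x ∂μ, ∀ᵐ y ∂μ, ‖∫ ξ, ((w ξ)⁻¹ : ℝ) * (m x ξ * conj (m y ξ))‖ ≤ k (x - y)) :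
    ∫ x, ‖∫ ξ, g ξ * m x ξ‖ ^ 2 ∂μ ≤ A * ∫ ξ, w ξ * ‖g ξ‖ ^ 2 := by
  set T : ℝ → ℂ := fun x => ∫ ξ, g ξ * m x ξ with hT
  set B : ℝ := ∫ ξ, ‖g ξ‖ with hB
  have hB0 : 0 ≤ B := integral_nonneg fun _ => norm_nonneg _
  have hTm : Measurable T := by
    refine StronglyMeasurable.measurable (StronglyMeasurable.integral_prod_right
      (f := fun x ξ => g ξ * m x ξ) (Measurable.stronglyMeasurable ?_))
    exact (hgm.comp measurable_snd).mul hm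
  have hTB : ∀ x, ‖T x‖ ≤ B := fun x => by
    refine norm_integral_le_of_norm_le hg.norm (ae_of_all _ fun ξ => ?_)
    rw [norm_mul]
    exact mul_le_of_le_one_right (norm_nonneg _) (hm1 x ξ)
  set h : ℝ → ℂ := fun x => conj (T x) with hh
  have hhm : Measurable h := Complex.continuous_conj.measurable.comp hTm
  have hhT : ∀ x, ‖h x‖ = ‖T x‖ := fun x => RCLike.norm_conj _
  have hhB : ∀ x, ‖h x‖ ≤ B := fun x => (hhT x).trans_le (hTB x)
  set H : ℝ → ℂ := fun ξ => ∫ x, h x * m x ξ ∂μ with hH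
  set J : ℝ := ∫ x, ‖T x‖ ^ 2 ∂μ with hJ
  have hJi : Integrable (fun x => ‖T x‖ ^ 2) μ := by
    refine Integrable.mono' (integrable_const (B ^ 2)) (hTm.norm.pow_const 2).aestronglyMeasurable
      (ae_of_all _ fun x => ?_)
    rw [Real.norm_of_nonneg (by positivity)]
    exact pow_le_pow_left₀ (norm_nonneg _) (hTB x) 2
  set V : ℝ := μ.real univ with hV
  have hHm : Measurable H := by
    refine StronglyMeasurable.measurable (StronglyMeasurable.integral_prod_right
      (f := fun ξ x => h x * m x ξ) (Measurable.stronglyMeasurable ?_))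
    exact (hhm.comp measurable_snd).mul (hm.comp measurable_swap)
  have hHV : ∀ ξ, ‖H ξ‖ ≤ B * V := fun ξ => by
    refine norm_integral_le_of_norm_le_const (ae_of_all _ fun x => ?_)
    rw [norm_mul]
    exact (mul_le_of_le_one_right (norm_nonneg _) (hm1 x ξ)).trans (hhB x)
  have hHΦ : ∀ ξ, (w ξ)⁻¹ * ‖H ξ‖ ≤ B * Φ ξ * V := fun ξ => by
    rw [inv_mul_le_iff₀ (hw0 ξ), ← mul_assoc]
    refine norm_integral_le_of_norm_le_const (ae_of_all _ fun x => ?_)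
    rw [norm_mul]
    have h1 := hmΦ x ξ
    rw [inv_mul_le_iff₀ (hw0 ξ)] at h1
    calc ‖h x‖ * ‖m x ξ‖ ≤ B * (w ξ * Φ ξ) := by
          gcongr
          exact hhB x
      _ = _ := by ring
  -- Duality: `‖T g‖²` is the pairing of `g` with `H = T* (T g)`.
  have hJH : (J : ℂ) = ∫ ξ, g ξ * H ξ := by
    have e1 : (J : ℂ) = ∫ x, (∫ ξ, h x * (g ξ * m x ξ)) ∂μ := by
      rw [hJ, ← integral_complex_ofReal]
      refine integral_congr_ae (ae_of_all _ fun x => ?_)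
      simp only [integral_const_mul]
      change _ = conj (T x) * T x
      rw [← Complex.normSq_eq_conj_mul_self, Complex.normSq_eq_norm_sq]
    rw [e1, integral_integral_swap]
    · refine integral_congr_ae (ae_of_all _ fun ξ => ?_)
      simp only [hH, ← integral_const_mul]
      exact integral_congr_ae (ae_of_all _ fun x => by ring)
    · refine Integrable.mono' ((hg.norm.const_mul B).comp_snd μ) ?_ (ae_of_all _ fun z => ?_)
      · exact ((hhm.comp measurable_fst).mul
          ((hgm.comp measurable_snd).mul hm)).aestronglyMeasurable
      · simp only [Function.uncurry, norm_mul]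
        exact mul_le_mul (hhB _) (mul_le_of_le_one_right (norm_nonneg _) (hm1 _ _))
          (by positivity) hB0
  set Q : ℝ := ∫ ξ, (w ξ)⁻¹ * ‖H ξ‖ ^ 2 with hQ
  have hQi : Integrable fun ξ => (w ξ)⁻¹ * ‖H ξ‖ ^ 2 := by
    refine Integrable.mono' (((hΦ.const_mul B).mul_const V).mul_const (B * V))
      (hw.inv.mul (hHm.norm.pow_const 2)).aestronglyMeasurable (ae_of_all _ fun ξ => ?_)
    have := hw0 ξ
    rw [Real.norm_of_nonneg (by positivity), sq, ← mul_assoc]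
    have h0 : 0 ≤ (w ξ)⁻¹ * ‖H ξ‖ := by positivity
    exact mul_le_mul (hHΦ ξ) (hHV ξ) (norm_nonneg _) (h0.trans (hHΦ ξ))
  have hsub : Measurable fun z : ℝ × ℝ => z.1 - z.2 := measurable_fst.sub measurable_snd
  have hkz : Integrable (fun z : ℝ × ℝ => k (z.1 - z.2)) (μ.prod μ) := by
    refine (integrable_prod_iff (hkm.comp hsub).aestronglyMeasurable).2 ⟨ae_of_all _ fun x => (hk.comp_sub_left x).mono_measure hμ, ?_⟩
    refine Integrable.mono' (integrable_const (∫ u, k u)) ?_ (ae_of_all _ fun x => ?_)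
    · exact (StronglyMeasurable.integral_prod_right (f := fun x y => ‖k (x - y)‖)
        (hkm.comp hsub).norm.stronglyMeasurable).aestronglyMeasurable
    · rw [Real.norm_of_nonneg (integral_nonneg fun _ => norm_nonneg _)]
      simp only [Function.comp_def, Real.norm_of_nonneg (hk0 _)]
      rw [← integral_sub_left_eq_self k volume x]
      exact integral_mono_measure hμ (ae_of_all _ fun _ => hk0 _) (hk.comp_sub_left x)
  have hkx : ∀ x, ∫ y, k (x - y) ∂μ ≤ A := fun x => by
    refine le_trans ?_ hkA
    rw [← integral_sub_left_eq_self k volume x]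
    exact integral_mono_measure hμ (ae_of_all _ fun _ => hk0 _) (hk.comp_sub_left x)
  have hky : ∀ y, ∫ x, k (x - y) ∂μ ≤ A := fun y => by
    refine le_trans ?_ hkA
    rw [← integral_sub_right_eq_self k y]
    exact integral_mono_measure hμ (ae_of_all _ fun _ => hk0 _) (hk.comp_sub_right y)
  have hS1i : Integrable (fun z : ℝ × ℝ => ‖T z.1‖ ^ 2 * k (z.1 - z.2)) (μ.prod μ) := by
    refine hkz.bdd_mul (c := B ^ 2) ((hTm.comp measurable_fst).norm.pow_const 2).aestronglyMeasurable
      (ae_of_all _ fun z => ?_)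
    rw [Real.norm_of_nonneg (by positivity)]
    exact pow_le_pow_left₀ (norm_nonneg _) (hTB _) 2
  have hS2i : Integrable (fun z : ℝ × ℝ => ‖T z.2‖ ^ 2 * k (z.1 - z.2)) (μ.prod μ) := by
    refine hkz.bdd_mul (c := B ^ 2) ((hTm.comp measurable_snd).norm.pow_const 2).aestronglyMeasurable
      (ae_of_all _ fun z => ?_)
    rw [Real.norm_of_nonneg (by positivity)]
    exact pow_le_pow_left₀ (norm_nonneg _) (hTB _) 2
  have hS1 : ∫ z, ‖T z.1‖ ^ 2 * k (z.1 - z.2) ∂(μ.prod μ) ≤ A * J := by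
    rw [integral_prod _ hS1i, hJ, ← integral_const_mul]
    refine integral_mono hS1i.integral_prod_left (hJi.const_mul A) fun x => ?_
    simp only [integral_const_mul]
    rw [mul_comm A]
    exact mul_le_mul_of_nonneg_left (hkx x) (by positivity)
  have hS2 : ∫ z, ‖T z.2‖ ^ 2 * k (z.1 - z.2) ∂(μ.prod μ) ≤ A * J := by
    rw [integral_prod_symm _ hS2i, hJ, ← integral_const_mul]
    refine integral_mono hS2i.integral_prod_right (hJi.const_mul A) fun y => ?_
    simp only [integral_const_mul]
    rw [mul_comm A]
    exact mul_le_mul_of_nonneg_left (hky y) (by positivity)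
  -- Schur's test for the kernel of `T T*`.
  have hQJ : Q ≤ A * J := by
    have e1 : (Q : ℂ) = ∫ ξ, ∫ z : ℝ × ℝ,
        ((w ξ)⁻¹ : ℝ) * ((h z.1 * m z.1 ξ) * conj (h z.2 * m z.2 ξ)) ∂(μ.prod μ) := by
      rw [hQ, ← integral_complex_ofReal]
      refine integral_congr_ae (ae_of_all _ fun ξ => ?_)
      simp only [integral_const_mul]
      rw [integral_prod_mul (fun x => h x * m x ξ) (fun y => conj (h y * m y ξ)), integral_conj]
      change _ = _ * (H ξ * conj (H ξ))
      rw [Complex.mul_conj, Complex.normSq_eq_norm_sq]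
      push_cast
      ring
    have e2 : (Q : ℂ) = ∫ z : ℝ × ℝ, h z.1 * conj (h z.2) *
        (∫ ξ, ((w ξ)⁻¹ : ℝ) * (m z.1 ξ * conj (m z.2 ξ))) ∂(μ.prod μ) := by
      rw [e1, integral_integral_swap]
      · refine integral_congr_ae (ae_of_all _ fun z => ?_)
        simp only [← integral_const_mul]
        refine integral_congr_ae (ae_of_all _ fun ξ => ?_)
        simp only [map_mul]
        ring
      · refine Integrable.mono' ((hΦ.const_mul (B * B)).comp_fst (μ.prod μ)) ?_
          (ae_of_all _ fun z => ?_)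
        · refine Measurable.aestronglyMeasurable ?_
          have m1 : Measurable fun z : ℝ × ℝ × ℝ => h z.2.1 * m z.2.1 z.1 :=
            (hhm.comp (measurable_fst.comp measurable_snd)).mul
              (hm.comp ((measurable_fst.comp measurable_snd).prodMk measurable_fst))
          have m2 : Measurable fun z : ℝ × ℝ × ℝ => h z.2.2 * m z.2.2 z.1 :=
            (hhm.comp (measurable_snd.comp measurable_snd)).mul
              (hm.comp ((measurable_snd.comp measurable_snd).prodMk measurable_fst))
          exact (Complex.measurable_ofReal.comp (hw.inv.comp measurable_fst)).mul
            (m1.mul (Complex.continuous_conj.measurable.comp m2))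
        · obtain ⟨ξ, x, y⟩ := z
          have hw0' := hw0 ξ
          simp only [Function.uncurry, norm_mul, RCLike.norm_conj, Complex.norm_real]
          rw [Real.norm_of_nonneg (by positivity)]
          have h1 := hmΦ x ξ
          calc (w ξ)⁻¹ * (‖h x‖ * ‖m x ξ‖ * (‖h y‖ * ‖m y ξ‖))
              ≤ (w ξ)⁻¹ * (B * ‖m x ξ‖ * (B * 1)) := by
                gcongr
                · exact hhB x
                · exact hhB y
                · exact hm1 y ξ
            _ = B * B * ((w ξ)⁻¹ * ‖m x ξ‖) := by ring
            _ ≤ B * B * Φ ξ := by gcongr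
    have hQ0 : 0 ≤ Q := integral_nonneg fun ξ => by have := hw0 ξ; positivity
    have e3 : Q ≤ ∫ z, (1 / 2 * (‖T z.1‖ ^ 2 * k (z.1 - z.2)) +
        1 / 2 * (‖T z.2‖ ^ 2 * k (z.1 - z.2))) ∂(μ.prod μ) := by
      have : Q = ‖(Q : ℂ)‖ := by rw [Complex.norm_real, Real.norm_of_nonneg hQ0]
      rw [this, e2]
      refine norm_integral_le_of_norm_le ((hS1i.const_mul _).add (hS2i.const_mul _)) ?_
      have hker' : ∀ᵐ z ∂(μ.prod μ),
          ‖∫ ξ, ((w ξ)⁻¹ : ℝ) * (m z.1 ξ * conj (m z.2 ξ))‖ ≤ k (z.1 - z.2) := by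
        rw [Measure.ae_prod_iff_ae_ae]
        · exact hker
        · refine measurableSet_le (Measurable.norm ?_) (hkm.comp hsub)
          refine StronglyMeasurable.measurable (StronglyMeasurable.integral_prod_right
            (f := fun (z : ℝ × ℝ) ξ => ((w ξ)⁻¹ : ℝ) * (m z.1 ξ * conj (m z.2 ξ)))
            (Measurable.stronglyMeasurable ?_))
          have m1 : Measurable fun z : (ℝ × ℝ) × ℝ => m z.1.1 z.2 :=
            hm.comp ((measurable_fst.comp measurable_fst).prodMk measurable_snd)
          have m2 : Measurable fun z : (ℝ × ℝ) × ℝ => m z.1.2 z.2 :=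
            hm.comp ((measurable_snd.comp measurable_fst).prodMk measurable_snd)
          exact (Complex.measurable_ofReal.comp (hw.inv.comp measurable_snd)).mul
            (m1.mul (Complex.continuous_conj.measurable.comp m2))
      filter_upwards [hker'] with z hz
      rw [norm_mul, norm_mul, hhT z.1,
        show ‖conj (h z.2)‖ = ‖T z.2‖ from (RCLike.norm_conj _).trans (hhT _)]
      have h2 := two_mul_le_add_sq ‖T z.1‖ ‖T z.2‖
      have h3 := hk0 (z.1 - z.2)
      calc ‖T z.1‖ * ‖T z.2‖ * ‖∫ ξ, ((w ξ)⁻¹ : ℝ) * (m z.1 ξ * conj (m z.2 ξ))‖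
          ≤ ‖T z.1‖ * ‖T z.2‖ * k (z.1 - z.2) := by gcongr
        _ ≤ ((‖T z.1‖ ^ 2 + ‖T z.2‖ ^ 2) / 2) * k (z.1 - z.2) := by gcongr; linarith
        _ = _ := by ring
    rw [integral_add (hS1i.const_mul _) (hS2i.const_mul _), integral_const_mul,
      integral_const_mul] at e3
    linarith
  -- The weighted inequality `2ab ≤ A a² + A⁻¹ b²` replaces Cauchy-Schwarz: the second term is
  -- absorbed, `J` being finite.
  have hfin : J ≤ ∫ ξ, (A / 2 * (w ξ * ‖g ξ‖ ^ 2) + (2 * A)⁻¹ * ((w ξ)⁻¹ * ‖H ξ‖ ^ 2)) := by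
    have hJ0 : 0 ≤ J := integral_nonneg fun x => by positivity
    have : J = ‖(J : ℂ)‖ := by rw [Complex.norm_real, Real.norm_of_nonneg hJ0]
    rw [this, hJH]
    refine norm_integral_le_of_norm_le ((hgw.const_mul _).add (hQi.const_mul _))
      (ae_of_all _ fun ξ => ?_)
    have hw0' := hw0 ξ
    rw [norm_mul]
    have h1 : 0 ≤ (A * w ξ * ‖g ξ‖ - ‖H ξ‖) ^ 2 / (2 * A * w ξ) := by positivity
    have h2 : A / 2 * (w ξ * ‖g ξ‖ ^ 2) + (2 * A)⁻¹ * ((w ξ)⁻¹ * ‖H ξ‖ ^ 2) - ‖g ξ‖ * ‖H ξ‖ =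
        (A * w ξ * ‖g ξ‖ - ‖H ξ‖) ^ 2 / (2 * A * w ξ) := by
      field_simp
      ring
    linarith
  rw [integral_add (hgw.const_mul _) (hQi.const_mul _), integral_const_mul,
    integral_const_mul] at hfin
  have h1 : (2 * A)⁻¹ * Q ≤ (2 * A)⁻¹ * (A * J) := by gcongr
  have h2 : (2 * A)⁻¹ * (A * J) = J / 2 := by field_simp
  linarith

/-! ### The maximal estimate above the critical exponent -/

theorem integrable_comp_abs {g : ℝ → ℝ} (hg : IntegrableOn g (Ioi 0)) :
    Integrable fun x => g |x| := by
  have h1 : IntegrableOn (fun x => g |x|) (Ioi 0) := by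
    refine hg.congr_fun (fun x hx => ?_) measurableSet_Ioi
    simp only [abs_of_pos (show (0 : ℝ) < x from hx)]
  have h2 : IntegrableOn (fun x => g |x|) (Iio 0) := by
    have h : IntegrableOn (fun x => g |x|) (Ioi (-0)) := by rwa [neg_zero]
    simpa only [abs_neg] using h.comp_neg_Iio
  have h3 : IntegrableOn (fun x => g |x|) (Iic 0 ∪ Ioi 0) :=
    ((integrableOn_Iic_iff_integrableOn_Iio).2 h2).union h1
  rwa [Iic_union_Ioi, integrableOn_univ] at h3

/-- The multiplier of `P^t` together with the character `exp(i x ξ)`. -/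
noncomputable def mult (a γ t x ξ : ℝ) : ℂ :=
  Complex.exp (Complex.I * (t * |ξ| ^ a : ℝ)) * (Real.exp (-(t ^ γ * |ξ| ^ a)) : ℂ) *
    Complex.exp (Complex.I * (x * ξ : ℝ))

theorem P_eq (a γ t : ℝ) (f : 𝓢(ℝ, ℂ)) (x : ℝ) :
    P a γ t f x = ∫ ξ, fhat f ξ * mult a γ t x ξ := by
  unfold P mult
  simp only [mul_assoc]

theorem norm_mult (a γ t x ξ : ℝ) : ‖mult a γ t x ξ‖ = Real.exp (-(t ^ γ * |ξ| ^ a)) := by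
  unfold mult
  rw [norm_mul, norm_mul, mul_comm Complex.I, mul_comm Complex.I, Complex.norm_exp_ofReal_mul_I,
    Complex.norm_exp_ofReal_mul_I, one_mul, mul_one, Complex.norm_real,
    Real.norm_of_nonneg (Real.exp_pos _).le]

theorem norm_mult_le_one {t : ℝ} (ht : 0 ≤ t) (a γ x ξ : ℝ) : ‖mult a γ t x ξ‖ ≤ 1 := by
  rw [norm_mult, Real.exp_le_one_iff]
  have : 0 ≤ t ^ γ * |ξ| ^ a := by positivity
  linarith

theorem measurable_mult (a γ : ℝ) {X : Type*} [MeasurableSpace X] {t x ξ : X → ℝ}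
    (ht : Measurable t) (hx : Measurable x) (hξ : Measurable ξ) :
    Measurable fun z => mult a γ (t z) (x z) (ξ z) := by
  have h1 : Measurable fun z => |ξ z| ^ a := hξ.abs.pow_const a
  have h2 : Measurable fun z => t z ^ γ := ht.pow_const γ
  unfold mult
  fun_prop

theorem continuous_mult_time {γ : ℝ} (hγ : 0 < γ) (a x ξ : ℝ) :
    Continuous fun t => mult a γ t x ξ := by
  have h : Continuous fun t : ℝ => t ^ γ :=
    Continuous.rpow_const continuous_id fun t => Or.inr hγ.le
  unfold mult
  fun_prop

theorem continuous_fhat (f : 𝓢(ℝ, ℂ)) : Continuous (fhat f) :=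
  (𝓕 f).continuous.comp (continuous_id.div_const _)

theorem integrable_fhat (f : 𝓢(ℝ, ℂ)) : Integrable (fhat f) :=
  (𝓕 f).integrable.comp_div (by positivity)

theorem measurable_P (a γ : ℝ) (f : 𝓢(ℝ, ℂ)) :
    Measurable fun p : ℝ × ℝ => P a γ p.1 f p.2 := by
  simp only [P_eq]
  refine StronglyMeasurable.measurable (StronglyMeasurable.integral_prod_right
    (f := fun (p : ℝ × ℝ) ξ => fhat f ξ * mult a γ p.1 p.2 ξ)
    (Measurable.stronglyMeasurable ?_))
  have h1 : Measurable fun z : (ℝ × ℝ) × ℝ => fhat f z.2 :=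
    (continuous_fhat f).measurable.comp measurable_snd
  have h2 : Measurable fun z : (ℝ × ℝ) × ℝ => mult a γ z.1.1 z.1.2 z.2 :=
    measurable_mult a γ (measurable_fst.comp measurable_fst)
      (measurable_snd.comp measurable_fst) measurable_snd
  exact h1.mul h2

theorem continuousOn_P {γ : ℝ} (hγ : 0 < γ) (a : ℝ) (f : 𝓢(ℝ, ℂ)) (x : ℝ) :
    ContinuousOn (fun t => P a γ t f x) (Ioo 0 1) := by
  simp only [P_eq]
  refine continuousOn_of_dominated (bound := fun ξ => ‖fhat f ξ‖) (fun t _ => ?_)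
    (fun t ht => ae_of_all _ fun ξ => ?_) (integrable_fhat f).norm (ae_of_all _ fun ξ => ?_)
  · exact ((continuous_fhat f).measurable.mul (measurable_mult a γ
      measurable_const measurable_const measurable_id)).aestronglyMeasurable
  · rw [norm_mul]
    exact mul_le_of_le_one_right (norm_nonneg _) (norm_mult_le_one ht.1.le a γ x ξ)
  · exact (continuous_const.mul (continuous_mult_time hγ a x ξ)).continuousOn

/-- The Sobolev weight `(1 + ξ²)^s`. -/
noncomputable def weight (s ξ : ℝ) : ℝ := (1 + ξ ^ 2) ^ s

theorem weight_pos (s ξ : ℝ) : 0 < weight s ξ := by unfold weight; positivity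

theorem sobolevNorm_eq (s : ℝ) (f : 𝓢(ℝ, ℂ)) : sobolevNorm s f =
    (∫⁻ ξ, ENNReal.ofReal (weight s ξ * ‖fhat f ξ‖ ^ 2)) ^ (1 / 2 : ℝ) := by
  unfold sobolevNorm
  rw [eLpNorm_eq_lintegral_rpow_enorm_toReal two_ne_zero ENNReal.ofNat_ne_top,
    ENNReal.toReal_ofNat]
  congr 2
  funext ξ
  have h : 0 ≤ 1 + ξ ^ 2 := by positivity
  rw [← ofReal_norm, ENNReal.ofReal_rpow_of_nonneg (norm_nonneg _) zero_le_two, norm_mul,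
    Complex.norm_real, Real.norm_of_nonneg (Real.rpow_nonneg h _), Real.rpow_two, mul_pow,
    weight, ← Real.rpow_natCast ((1 + ξ ^ 2) ^ (s / 2)), ← Real.rpow_mul h]
  norm_num

theorem continuous_weight (s : ℝ) : Continuous (weight s) :=
  Continuous.rpow_const (by fun_prop) fun ξ => Or.inl (by positivity)

open ComplexConjugate in
/-- The integrand of the kernel of `T T*` depends only on differences of positions and times, and on
the sum `t₁ ^ γ + t₂ ^ γ`. -/
theorem inv_weight_mul_mult (a γ s t₁ t₂ x y ξ : ℝ) :
    ((weight s ξ)⁻¹ : ℝ) * (mult a γ t₁ x ξ * conj (mult a γ t₂ y ξ)) =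
      Complex.exp (Complex.I * (((x - y) * ξ + (t₁ - t₂) * |ξ| ^ a : ℝ) : ℂ)) *
        (ampl a s (t₁ ^ γ + t₂ ^ γ) |ξ| : ℂ) := by
  have h : (weight s ξ)⁻¹ = (1 + |ξ| ^ 2) ^ (-s) := by
    rw [weight, sq_abs, Real.rpow_neg (by positivity)]
  rw [h]
  unfold mult ampl
  simp only [map_mul, Complex.conj_ofReal, ← Complex.exp_conj, Complex.conj_I]
  push_cast
  simp only [← Complex.exp_add]
  rw [mul_left_comm (Complex.exp _), ← Complex.exp_add]
  congr 2
  ring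

/-- The estimate for `P` along a measurable choice of times. The lower bound `τ` makes the kernel
absolutely convergent; the constant does not depend on it. -/
theorem exists_integral_norm_sq_P_le {a γ s β ρ : ℝ} (ha : 1 < a) (hγ : 0 < γ) (hs : 0 ≤ s)
    (hβ0 : 1 / 2 ≤ β) (hβ1 : β < 1) (hρ : 0 < ρ) (hρ1 : 1 - β - 2 * s ≤ -ρ)
    (hρ2 : 1 / 2 - 2 * s - (β - 1 / 2) * (1 - a + a / γ) ≤ -ρ) :
    ∃ A : ℝ, 0 < A ∧ ∀ f : 𝓢(ℝ, ℂ), Integrable (fun ξ => weight s ξ * ‖fhat f ξ‖ ^ 2) →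
      ∀ (t : ℝ → ℝ) (τ : ℝ), Measurable t → 0 < τ → (∀ x, τ ≤ t x) →
        ∫ x in Icc (-1 : ℝ) 1, ‖P a γ (t x) f x‖ ^ 2 ≤
          A * ∫ ξ, weight s ξ * ‖fhat f ξ‖ ^ 2 := by
  obtain ⟨C, hC0, hC⟩ := exists_norm_kernel_le ha hγ hs hβ0 hβ1.le hρ hρ1 hρ2
  set k : ℝ → ℝ := indicator (Icc (-2) 2) fun u => C * |u| ^ (-β) with hk
  have hkm : Measurable k :=
    ((measurable_id.abs.pow_const (-β)).const_mul C).indicator measurableSet_Icc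
  have hk0 : ∀ u, 0 ≤ k u := fun u => indicator_nonneg (fun _ _ => by positivity) u
  have hki : Integrable k := by
    rw [hk, integrable_indicator_iff measurableSet_Icc]
    refine LocallyIntegrable.integrableOn_isCompact
      (locallyIntegrable_of_norm_le_rpow (α := β) (C := C) (by simp) (by simpa using hβ1)
        (ae_of_all _ fun u => ?_)
        ((measurable_id.abs.pow_const (-β)).const_mul C).aestronglyMeasurable) isCompact_Icc
    rw [Real.norm_of_nonneg (by positivity), Real.norm_eq_abs]
  have hk1 : 0 ≤ ∫ u, k u := integral_nonneg hk0
  refine ⟨(∫ u, k u) + 1, by linarith, fun f hf t τ ht hτ hτt => ?_⟩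
  have htpos : ∀ x, 0 < t x := fun x => hτ.trans_le (hτt x)
  simp only [P_eq]
  refine integral_norm_sq_le_of_kernel_le (m := fun x ξ => mult a γ (t x) x ξ)
    (Φ := fun ξ => ampl a s (τ ^ γ) |ξ|) (k := k)
    Measure.restrict_le_self (by linarith) ?_ (fun x ξ => norm_mult_le_one (htpos x).le a γ x ξ)
    (continuous_weight s).measurable (weight_pos s) (integrable_fhat f)
    (continuous_fhat f).measurable hf
    (integrable_comp_abs (integrableOn_ampl ha hs (by positivity))) ?_ hki hkm hk0
    (by linarith) ?_
  · exact measurable_mult a γ (ht.comp measurable_fst) measurable_fst measurable_snd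
  · intro x ξ
    rw [norm_mult, ampl, weight, sq_abs, Real.rpow_neg (by positivity)]
    gcongr
    exact hτt x
  · filter_upwards [ae_restrict_mem measurableSet_Icc] with x hx
    filter_upwards [ae_restrict_mem measurableSet_Icc,
      ae_restrict_of_ae (Measure.ae_ne volume x)] with y hy hyx
    have hxy : x - y ≠ 0 := sub_ne_zero.2 hyx.symm
    have hu : x - y ∈ Icc (-2 : ℝ) 2 := ⟨by linarith [hx.1, hy.2], by linarith [hx.2, hy.1]⟩
    simp only [inv_weight_mul_mult]
    rw [hk, indicator_of_mem hu]
    have h1 := htpos x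
    have h2 := htpos y
    refine hC (x - y) (t x - t y) _ hxy (abs_le.2 hu) (by positivity) ?_
    rcases le_total (t x) (t y) with h | h
    · have : |t x - t y| ^ γ ≤ t y ^ γ := by
        rw [abs_of_nonpos (by linarith)]
        exact Real.rpow_le_rpow (by linarith) (by linarith) hγ.le
      have : 0 ≤ t x ^ γ := by positivity
      linarith
    · have : |t x - t y| ^ γ ≤ t x ^ γ := by
        rw [abs_of_nonneg (by linarith)]
        exact Real.rpow_le_rpow (by linarith) (by linarith) hγ.le
      have : 0 ≤ t y ^ γ := by positivity
      linarith

/-- The maximum over finitely many times is attained along a measurable choice of times. -/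
theorem exists_measurable_argmax {E : Type*} [MeasurableSpace E] [NormedAddCommGroup E]
    [OpensMeasurableSpace E] {G : ℝ → ℝ → E} (hG : Measurable (Function.uncurry G))
    (q : ℕ → ℝ) (hq : ∀ i, 0 < q i) (n : ℕ) :
    ∃ (t : ℝ → ℝ) (τ : ℝ), Measurable t ∧ 0 < τ ∧ (∀ x, τ ≤ t x) ∧
      ∀ x, ∀ i ≤ n, ‖G (q i) x‖ ≤ ‖G (t x) x‖ := by
  induction n with
  | zero =>
    exact ⟨fun _ => q 0, q 0, measurable_const, hq 0, fun _ => le_rfl,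
      fun x i hi => by rw [Nat.le_zero.1 hi]⟩
  | succ n ih =>
    obtain ⟨t, τ, htm, hτ, hτt, hmax⟩ := ih
    classical
    set S : Set ℝ := {x | ‖G (t x) x‖ ≤ ‖G (q (n + 1)) x‖} with hS
    have hSm : MeasurableSet S := measurableSet_le
      (hG.comp (htm.prodMk measurable_id)).norm
      (hG.comp (measurable_const.prodMk measurable_id)).norm
    refine ⟨S.piecewise (fun _ => q (n + 1)) t, min τ (q (n + 1)),
      Measurable.piecewise hSm measurable_const htm, lt_min hτ (hq _), fun x => ?_,
      fun x i hi => ?_⟩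
    · by_cases hx : x ∈ S
      · rw [piecewise_eq_of_mem _ _ _ hx]; exact min_le_right _ _
      · rw [piecewise_eq_of_notMem _ _ _ hx]; exact (min_le_left _ _).trans (hτt x)
    · by_cases hx : x ∈ S
      · rw [piecewise_eq_of_mem _ _ _ hx]
        rcases Nat.le_succ_iff.1 hi with h | h
        · exact (hmax x i h).trans hx
        · rw [h]
      · rw [piecewise_eq_of_notMem _ _ _ hx]
        rcases Nat.le_succ_iff.1 hi with h | h
        · exact hmax x i h
        · rw [h]; exact (not_le.1 hx).le

/-- Passage from measurable choices of times to the maximal function: by continuity in time a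
countable dense set of times suffices, and monotone convergence reduces it to finite sets. -/
theorem lintegral_maximalP_le {a γ : ℝ} (hγ : 0 < γ) {f : 𝓢(ℝ, ℂ)} {R : ℝ≥0∞} {μ : Measure ℝ}
    (h : ∀ (t : ℝ → ℝ) (τ : ℝ), Measurable t → 0 < τ → (∀ x, τ ≤ t x) →
      ∫⁻ x, ‖P a γ (t x) f x‖ₑ ^ (2 : ℝ) ∂μ ≤ R) :
    ∫⁻ x, maximalP a γ f x ^ (2 : ℝ) ∂μ ≤ R := by
  have : Nonempty (Ioo (0 : ℝ) 1) := ⟨⟨1 / 2, by norm_num, by norm_num⟩⟩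
  set q : ℕ → Ioo (0 : ℝ) 1 := TopologicalSpace.denseSeq _ with hq
  set M : ℕ → ℝ → ℝ≥0∞ := fun n x => ⨆ i ≤ n, ‖P a γ (q i) f x‖ₑ with hM
  have hPm : ∀ t : ℝ, Measurable fun x => ‖P a γ t f x‖ₑ := fun t =>
    ((measurable_P a γ f).comp (measurable_const.prodMk measurable_id)).enorm
  have hle : ∀ x, maximalP a γ f x ≤ ⨆ n, M n x := fun x => by
    refine iSup₂_le fun t ht => ?_
    have hcl : IsClosed {t : Ioo (0 : ℝ) 1 | ‖P a γ t f x‖ₑ ≤ ⨆ n, M n x} :=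
      isClosed_le (continuousOn_iff_continuous_domRestrict.1 (continuousOn_P hγ a f x)).enorm
        continuous_const
    have hall : ∀ t : Ioo (0 : ℝ) 1, ‖P a γ t f x‖ₑ ≤ ⨆ n, M n x := fun t =>
      (TopologicalSpace.denseRange_denseSeq (Ioo (0 : ℝ) 1)).induction_on
        (p := fun t : Ioo (0 : ℝ) 1 => ‖P a γ t f x‖ₑ ≤ ⨆ n, M n x) t hcl fun i =>
          (le_iSup₂ (f := fun j (_ : j ≤ i) => ‖P a γ (q j) f x‖ₑ) i le_rfl).trans
            (le_iSup (fun n => M n x) i)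
    exact hall ⟨t, ht⟩
  have hMmono : Monotone fun n x => M n x ^ (2 : ℝ) := fun n₁ n₂ hn x =>
    ENNReal.rpow_le_rpow (biSup_mono fun i hi => le_trans hi hn) zero_le_two
  have hMm : ∀ n, Measurable fun x => M n x ^ (2 : ℝ) := fun n =>
    (Measurable.iSup fun i => Measurable.iSup fun _ => hPm _).pow_const 2
  calc ∫⁻ x, maximalP a γ f x ^ (2 : ℝ) ∂μ ≤ ∫⁻ x, ⨆ n, M n x ^ (2 : ℝ) ∂μ := by
        refine lintegral_mono fun x => ?_
        refine (ENNReal.rpow_le_rpow (hle x) zero_le_two).trans (le_of_eq ?_)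
        exact (ENNReal.orderIsoRpow 2 zero_lt_two).map_iSup _
    _ = ⨆ n, ∫⁻ x, M n x ^ (2 : ℝ) ∂μ := lintegral_iSup hMm hMmono
    _ ≤ R := by
        refine iSup_le fun n => ?_
        obtain ⟨t, τ, htm, hτ, hτt, hmax⟩ := exists_measurable_argmax
          (G := fun t x => P a γ t f x) (measurable_P a γ f) (fun i => q i)
          (fun i => (q i).2.1) n
        refine le_trans (lintegral_mono fun x => ?_) (h t τ htm hτ hτt)
        refine ENNReal.rpow_le_rpow (iSup₂_le fun i hi => ?_) zero_le_two
        rw [← ofReal_norm, ← ofReal_norm]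
        exact ENNReal.ofReal_le_ofReal (hmax x i hi)

/-- The maximal estimate, given an exponent `β < 1` for which the dyadic blocks of the kernel are
summable. -/
theorem localMaximalEstimate_of_exponents {a γ s β ρ : ℝ} (ha : 1 < a) (hγ : 0 < γ) (hs : 0 ≤ s)
    (hβ0 : 1 / 2 ≤ β) (hβ1 : β < 1) (hρ : 0 < ρ) (hρ1 : 1 - β - 2 * s ≤ -ρ)
    (hρ2 : 1 / 2 - 2 * s - (β - 1 / 2) * (1 - a + a / γ) ≤ -ρ) :
    LocalMaximalEstimate a γ s := by
  obtain ⟨A, hA0, hA⟩ := exists_integral_norm_sq_P_le ha hγ hs hβ0 hβ1 hρ hρ1 hρ2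
  have hc0 : (Real.toNNReal A) ^ (1 / 2 : ℝ) ≠ 0 := by
    have : 0 < Real.toNNReal A := Real.toNNReal_pos.2 hA0
    positivity
  refine ⟨(Real.toNNReal A) ^ (1 / 2 : ℝ), fun f => ?_⟩
  rw [sobolevNorm_eq]
  set L : ℝ≥0∞ := ∫⁻ ξ, ENNReal.ofReal (weight s ξ * ‖fhat f ξ‖ ^ 2) with hL
  -- For an infinite Sobolev norm the right-hand side is infinite, the constant being nonzero.
  by_cases hLtop : L = ∞
  · rw [hLtop, ENNReal.top_rpow_of_pos (by norm_num), ENNReal.mul_top (by exact_mod_cast hc0)]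
    exact le_top
  have hwm : Continuous fun ξ => weight s ξ * ‖fhat f ξ‖ ^ 2 :=
    (continuous_weight s).mul ((continuous_fhat f).norm.pow 2)
  have hw0 : ∀ ξ, 0 ≤ weight s ξ * ‖fhat f ξ‖ ^ 2 := fun ξ =>
    mul_nonneg (weight_pos s ξ).le (by positivity)
  have hf : Integrable fun ξ => weight s ξ * ‖fhat f ξ‖ ^ 2 := by
    refine ⟨hwm.aestronglyMeasurable, ?_⟩
    rw [hasFiniteIntegral_iff_ofReal (ae_of_all _ hw0)]
    exact lt_top_iff_ne_top.2 hLtop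
  have hLint : ENNReal.ofReal (∫ ξ, weight s ξ * ‖fhat f ξ‖ ^ 2) = L :=
    ofReal_integral_eq_lintegral_ofReal hf (ae_of_all _ hw0)
  have hmain : ∫⁻ x, maximalP a γ f x ^ (2 : ℝ) ∂(volume.restrict (Icc (-1 : ℝ) 1)) ≤
      ENNReal.ofReal A * L := by
    refine lintegral_maximalP_le hγ fun t τ ht hτ hτt => ?_
    have hb : ∀ x, ‖P a γ (t x) f x‖ ≤ ∫ ξ, ‖fhat f ξ‖ := fun x => by
      rw [P_eq]
      refine norm_integral_le_of_norm_le (integrable_fhat f).norm (ae_of_all _ fun ξ => ?_)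
      rw [norm_mul]
      exact mul_le_of_le_one_right (norm_nonneg _)
        (norm_mult_le_one (hτ.le.trans (hτt x)) a γ x ξ)
    have hi : Integrable (fun x => ‖P a γ (t x) f x‖ ^ 2) (volume.restrict (Icc (-1 : ℝ) 1)) := by
      refine Integrable.mono' (integrable_const ((∫ ξ, ‖fhat f ξ‖) ^ 2))
        (((measurable_P a γ f).comp (ht.prodMk measurable_id)).norm.pow_const
          2).aestronglyMeasurable (ae_of_all _ fun x => ?_)
      rw [Real.norm_of_nonneg (by positivity)]
      exact pow_le_pow_left₀ (norm_nonneg _) (hb x) 2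
    have := hA f hf t τ ht hτ hτt
    calc ∫⁻ x in Icc (-1 : ℝ) 1, ‖P a γ (t x) f x‖ₑ ^ (2 : ℝ)
        = ∫⁻ x in Icc (-1 : ℝ) 1, ENNReal.ofReal (‖P a γ (t x) f x‖ ^ 2) := by
          refine lintegral_congr fun x => ?_
          rw [← ofReal_norm, ENNReal.ofReal_rpow_of_nonneg (norm_nonneg _) zero_le_two,
            Real.rpow_two]
      _ = ENNReal.ofReal (∫ x in Icc (-1 : ℝ) 1, ‖P a γ (t x) f x‖ ^ 2) :=
          (ofReal_integral_eq_lintegral_ofReal hi (ae_of_all _ fun x => by positivity)).symm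
      _ ≤ ENNReal.ofReal (A * ∫ ξ, weight s ξ * ‖fhat f ξ‖ ^ 2) := ENNReal.ofReal_le_ofReal this
      _ = ENNReal.ofReal A * L := by rw [ENNReal.ofReal_mul hA0.le, hLint]
  rw [eLpNorm_eq_lintegral_rpow_enorm_toReal two_ne_zero ENNReal.ofNat_ne_top,
    ENNReal.toReal_ofNat]
  simp only [enorm_eq_self]
  refine (ENNReal.rpow_le_rpow hmain (by norm_num)).trans (le_of_eq ?_)
  rw [ENNReal.mul_rpow_of_nonneg _ _ (by norm_num), ENNReal.coe_rpow_of_nonneg _ (by norm_num)]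
  rfl

/-- The estimate above the critical exponent. -/
theorem localMaximalEstimate_of_lt {a γ s : ℝ} (ha : 1 < a) (hγ : 0 < γ) (hs : 0 < s)
    (h : min (1 / 4 * a * max 0 (1 - 1 / γ)) (1 / 4) < s) : LocalMaximalEstimate a γ s := by
  rcases min_lt_iff.1 h with h | h
  · have h1 : 1 / 4 * a * (1 - 1 / γ) < s :=
      lt_of_le_of_lt (mul_le_mul_of_nonneg_left (le_max_right _ _) (by linarith)) h
    -- As `β → 1` the two exponents tend to `-2s` and to `-2s + a (1 - 1/γ) / 2`.
    set e : ℝ := 1 - a + a / γ with he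
    have he' : 1 / 4 * a * (1 - 1 / γ) = (1 - e) / 4 := by rw [he]; ring
    set d : ℝ := min s (s - (1 - e) / 4) with hd
    have hd0 : 0 < d := lt_min hs (by linarith)
    set η : ℝ := min (1 / 2) (d / (1 + |e|)) with hη
    have hη0 : 0 < η := lt_min (by norm_num) (by positivity)
    have hη1 : η ≤ 1 / 2 := min_le_left _ _
    have hη2 : η * (1 + |e|) ≤ d := by
      rw [← le_div_iff₀ (by positivity)]; exact min_le_right _ _
    have hds : d ≤ s := min_le_left _ _
    have hds' : d ≤ s - (1 - e) / 4 := min_le_right _ _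
    have h3 : η * e ≤ η * |e| := mul_le_mul_of_nonneg_left (le_abs_self e) hη0.le
    have h4 : 0 ≤ η * |e| := by positivity
    refine localMaximalEstimate_of_exponents (β := 1 - η) (ρ := d) ha hγ hs.le (by linarith)
      (by linarith) hd0 (by linarith) ?_
    have : (1 - η - 1 / 2) * e = e / 2 - η * e := by ring
    rw [this]
    linarith
  · refine localMaximalEstimate_of_exponents (β := 1 / 2) (ρ := 2 * s - 1 / 2) ha hγ hs.le le_rfl
      (by norm_num) (by linarith) (by linarith) (by linarith)

/-! ### Wave packets and necessity of the exponent -/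

/-- Quadratic Taylor remainder of `(1 + v) ^ a` at `0`. -/
theorem abs_one_add_rpow_sub_le {a v : ℝ} (ha : 1 < a) (hv : |v| ≤ 1 / 2) :
    |(1 + v) ^ a - 1 - a * v| ≤ a * (a - 1) * 2 ^ a * v ^ 2 := by
  have ha1 : 0 < a - 1 := by linarith
  have h0 : (0 : ℝ) ∈ Icc (-|v|) |v| := ⟨by linarith [abs_nonneg v], abs_nonneg v⟩
  have hpos : ∀ w ∈ Icc (-|v|) |v|, 1 / 2 ≤ 1 + w ∧ 1 + w ≤ 2 := fun w hw =>
    ⟨by linarith [hw.1], by linarith [hw.2]⟩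
  have hd : ∀ (p w : ℝ), w ∈ Icc (-|v|) |v| →
      HasDerivAt (fun w => (1 + w) ^ p) (p * (1 + w) ^ (p - 1)) w := fun p w hw => by
    have := ((hasDerivAt_id w).const_add 1).rpow_const (p := p)
      (Or.inl (by have := (hpos w hw).1; simp only [id]; linarith))
    simpa using this
  have h1 : ∀ w ∈ Icc (-|v|) |v|, |(1 + w) ^ (a - 1) - 1| ≤ (a - 1) * 2 ^ a * |v| := by
    intro w hw
    have := Convex.norm_image_sub_le_of_norm_hasDerivWithin_le (C := (a - 1) * 2 ^ a)
      (fun w hw => (hd (a - 1) w hw).hasDerivWithinAt) (fun w hw => ?_)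
      (convex_Icc (-|v|) |v|) h0 hw
    · simp only [add_zero, Real.one_rpow, sub_zero, Real.norm_eq_abs] at this
      exact this.trans (mul_le_mul_of_nonneg_left (abs_le.2 hw) (by positivity))
    · obtain ⟨p1, p2⟩ := hpos w hw
      have p0 : 0 < 1 + w := by linarith
      rw [Real.norm_of_nonneg (by positivity), Real.rpow_sub_one p0.ne']
      gcongr
      rw [div_le_iff₀ p0]
      have e1 : (1 + w) ^ (a - 1) ≤ 2 ^ (a - 1) := by gcongr
      have e2 : (2 : ℝ) ^ a = 2 * 2 ^ (a - 1) := by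
        rw [Real.rpow_sub_one (by norm_num)]; ring
      have e3 : (0 : ℝ) < 2 ^ (a - 1) := by positivity
      nlinarith
  have hvm : v ∈ Icc (-|v|) |v| := ⟨neg_abs_le v, le_abs_self v⟩
  have h2 := Convex.norm_image_sub_le_of_norm_hasDerivWithin_le
    (f := fun w => (1 + w) ^ a - 1 - a * w) (f' := fun w => a * (1 + w) ^ (a - 1) - a)
    (C := a * ((a - 1) * 2 ^ a * |v|))
    (fun w hw => by
      have := ((hd a w hw).sub_const 1).sub ((hasDerivAt_id w).const_mul a)
      rw [mul_one] at this
      exact this.hasDerivWithinAt)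
    (fun w hw => by
      rw [← mul_sub_one, norm_mul, Real.norm_of_nonneg (by linarith : (0 : ℝ) ≤ a)]
      exact mul_le_mul_of_nonneg_left (h1 w hw) (by linarith))
    (convex_Icc (-|v|) |v|) h0 hvm
  simp only [add_zero, Real.one_rpow, sub_self, mul_zero, sub_zero, Real.norm_eq_abs] at h2
  refine h2.trans (le_of_eq ?_)
  rw [← sq_abs v]
  ring

/-- A Schwartz function whose Fourier transform is a bump at frequency `N` of width `W`. -/
theorem exists_schwartz_fhat_bump (N : ℝ) {W : ℝ} (hW : 0 < W) :
    ∃ (f : 𝓢(ℝ, ℂ)) (b : ℝ → ℝ), (∀ ξ, fhat f ξ = b ξ) ∧ (∀ ξ, 0 ≤ b ξ) ∧ (∀ ξ, b ξ ≤ 1) ∧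
      (∀ ξ, |ξ - N| ≤ W → b ξ = 1) ∧ ∀ ξ, 2 * W ≤ |ξ - N| → b ξ = 0 := by
  have hπ : 0 < 2 * Real.pi := by positivity
  let φ : ContDiffBump (N / (2 * Real.pi)) :=
    ⟨W / (2 * Real.pi), 2 * W / (2 * Real.pi), by positivity, by gcongr; linarith⟩
  have hsupp : HasCompactSupport fun w => (φ w : ℂ) :=
    φ.hasCompactSupport.comp_left Complex.ofReal_zero
  have hsmooth : ContDiff ℝ (⊤ : ℕ∞) fun w => (φ w : ℂ) :=
    Complex.ofRealCLM.contDiff.comp φ.contDiff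
  let h : 𝓢(ℝ, ℂ) := hsupp.toSchwartzMap hsmooth
  have hdist : ∀ ξ, dist (ξ / (2 * Real.pi)) (N / (2 * Real.pi)) = |ξ - N| / (2 * Real.pi) :=
    fun ξ => by rw [Real.dist_eq, ← sub_div, abs_div, abs_of_pos hπ]
  refine ⟨𝓕⁻ h, fun ξ => φ (ξ / (2 * Real.pi)), fun ξ => ?_, fun ξ => φ.nonneg,
    fun ξ => φ.le_one, fun ξ hξ => ?_, fun ξ hξ => ?_⟩
  · rw [fhat, FourierTransform.fourier_fourierInv_eq]
    rfl
  · refine φ.one_of_mem_closedBall ?_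
    rw [Metric.mem_closedBall, hdist]
    change _ ≤ W / (2 * Real.pi)
    gcongr
  · refine φ.zero_of_le_dist ?_
    rw [hdist]
    change 2 * W / (2 * Real.pi) ≤ _
    gcongr

/-- A wave packet stays coherent along its group velocity: at `x = -a t N^{a-1}` the phase is
stationary at frequency `N`, and `|P^t f(x)|` is comparable to the width `W` as long as the
quadratic term of the phase and the dissipation are bounded. -/
theorem le_norm_P_of_bump {a γ N W t x E : ℝ} (ha : 1 < a) (hN : 0 < N) (hW : 0 < W)
    (hWN : 2 * W ≤ N / 2) (ht : 0 ≤ t) (hx : x = -(a * t * N ^ (a - 1)))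
    (hphase : t * N ^ a * (a * (a - 1) * 2 ^ a * (2 * W / N) ^ 2) ≤ 1)
    (hE : t ^ γ * (2 * N) ^ a ≤ E) {f : 𝓢(ℝ, ℂ)} {b : ℝ → ℝ} (hb : ∀ ξ, fhat f ξ = b ξ)
    (hb0 : ∀ ξ, 0 ≤ b ξ) (hb1 : ∀ ξ, |ξ - N| ≤ W → b ξ = 1)
    (hb2 : ∀ ξ, 2 * W ≤ |ξ - N| → b ξ = 0) :
    W * Real.exp (-E) ≤ ‖P a γ t f x‖ := by
  have ha1 : 0 < a - 1 := by linarith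
  set φ : ℝ → ℝ := fun ξ => t * |ξ| ^ a + x * ξ with hφ
  have hi : Integrable fun ξ => fhat f ξ * mult a γ t x ξ := by
    refine (integrable_fhat f).norm.mono' ?_ (ae_of_all _ fun ξ => ?_)
    · exact ((continuous_fhat f).measurable.mul
        (measurable_mult a γ measurable_const measurable_const measurable_id)).aestronglyMeasurable
    · rw [norm_mul]
      exact mul_le_of_le_one_right (norm_nonneg _) (norm_mult_le_one ht a γ x ξ)
  have hcos : ∀ ξ, |ξ - N| ≤ 2 * W →
      1 / 2 ≤ Real.cos (φ ξ - φ N) ∧ Real.exp (-E) ≤ Real.exp (-(t ^ γ * |ξ| ^ a)) := by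
    intro ξ hξ
    set v : ℝ := (ξ - N) / N with hv
    have hξv : ξ = N * (1 + v) := by rw [hv]; field_simp; ring
    have hv' : |v| ≤ 2 * W / N := by
      rw [hv, abs_div, abs_of_pos hN]; gcongr
    have hv2 : |v| ≤ 1 / 2 := hv'.trans (by rw [div_le_iff₀ hN]; linarith)
    have hv1 : 0 < 1 + v := by linarith [neg_abs_le v]
    have hξ0 : 0 < ξ := by rw [hξv]; positivity
    have hξa : |ξ| ^ a = N ^ a * (1 + v) ^ a := by
      rw [abs_of_pos hξ0, hξv, Real.mul_rpow hN.le hv1.le]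
    have hNa : N ^ (a - 1) * N = N ^ a := by
      rw [Real.rpow_sub_one hN.ne']; field_simp
    have hdiff : φ ξ - φ N = t * N ^ a * ((1 + v) ^ a - 1 - a * v) := by
      simp only [hφ]
      rw [hξa, abs_of_pos hN, hx, hξv, ← hNa]
      ring
    have hsmall : |φ ξ - φ N| ≤ 1 := by
      rw [hdiff, abs_mul, abs_of_nonneg (by positivity)]
      refine le_trans ?_ hphase
      gcongr
      refine (abs_one_add_rpow_sub_le ha hv2).trans (mul_le_mul_of_nonneg_left ?_ (by positivity))
      rw [← sq_abs v]
      gcongr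
    constructor
    · have h1 := Real.one_sub_sq_div_two_le_cos (x := φ ξ - φ N)
      have h2 : (φ ξ - φ N) ^ 2 ≤ 1 := by rw [← sq_abs]; nlinarith [abs_nonneg (φ ξ - φ N)]
      linarith
    · gcongr
      refine le_trans ?_ hE
      gcongr
      rw [abs_of_pos hξ0, hξv]
      nlinarith [le_abs_self v]
  -- Removing the phase at frequency `N` makes the integrand have nonnegative real part.
  set θ : ℂ := Complex.exp (-(Complex.I * (φ N : ℝ))) with hθ
  have hθ1 : ‖θ‖ = 1 := by
    rw [hθ, show -(Complex.I * (φ N : ℝ)) = ((-φ N : ℝ) : ℂ) * Complex.I by push_cast; ring,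
      Complex.norm_exp_ofReal_mul_I]
  have hre : ∀ ξ, (θ * (fhat f ξ * mult a γ t x ξ)).re =
      b ξ * Real.exp (-(t ^ γ * |ξ| ^ a)) * Real.cos (φ ξ - φ N) := by
    intro ξ
    have : θ * (fhat f ξ * mult a γ t x ξ) =
        ((b ξ * Real.exp (-(t ^ γ * |ξ| ^ a)) : ℝ) : ℂ) *
          Complex.exp (((φ ξ - φ N : ℝ) : ℂ) * Complex.I) := by
      have e : Complex.exp (((φ ξ - φ N : ℝ) : ℂ) * Complex.I) =
          θ * (Complex.exp (Complex.I * (t * |ξ| ^ a : ℝ)) *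
            Complex.exp (Complex.I * (x * ξ : ℝ))) := by
        rw [hθ, ← Complex.exp_add, ← Complex.exp_add]
        congr 1
        simp only [hφ]
        push_cast
        ring
      rw [e, hb, mult, Complex.ofReal_mul (b ξ)]
      ring
    rw [this, Complex.re_ofReal_mul, Complex.exp_ofReal_mul_I_re]
  have hlow : ∀ ξ, indicator (Icc (N - W) (N + W)) (fun _ => Real.exp (-E) * (1 / 2)) ξ ≤
      (θ * (fhat f ξ * mult a γ t x ξ)).re := by
    intro ξ
    rw [hre]
    by_cases hξ : ξ ∈ Icc (N - W) (N + W)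
    · have h1 : |ξ - N| ≤ W := abs_le.2 ⟨by linarith [hξ.1], by linarith [hξ.2]⟩
      obtain ⟨h2, h3⟩ := hcos ξ (by linarith)
      rw [indicator_of_mem hξ, hb1 ξ h1, one_mul]
      gcongr
    · rw [indicator_of_notMem hξ]
      rcases le_total (2 * W) |ξ - N| with h | h
      · rw [hb2 ξ h]; simp
      · obtain ⟨h2, h3⟩ := hcos ξ h
        exact mul_nonneg (mul_nonneg (hb0 ξ) (Real.exp_pos _).le) (by linarith)
  have hint : ∫ ξ, indicator (Icc (N - W) (N + W)) (fun _ => Real.exp (-E) * (1 / 2)) ξ =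
      W * Real.exp (-E) := by
    rw [integral_indicator measurableSet_Icc, setIntegral_const, Measure.real, Real.volume_Icc,
      ENNReal.toReal_ofReal (by linarith), smul_eq_mul]
    ring
  calc W * Real.exp (-E)
      = ∫ ξ, indicator (Icc (N - W) (N + W)) (fun _ => Real.exp (-E) * (1 / 2)) ξ := hint.symm
    _ ≤ ∫ ξ, (θ * (fhat f ξ * mult a γ t x ξ)).re := by
        refine integral_mono ?_ (hi.const_mul θ).re hlow
        rw [integrable_indicator_iff measurableSet_Icc]
        exact integrableOn_const (by simp)
    _ = (θ * P a γ t f x).re := by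
        rw [P_eq, ← integral_const_mul]
        exact integral_re (hi.const_mul θ)
    _ ≤ ‖θ * P a γ t f x‖ := Complex.re_le_norm _
    _ = ‖P a γ t f x‖ := by rw [norm_mul, hθ1, one_mul]

/-- The squared Sobolev norm of a wave packet is `O(N^{2s} W)`. -/
theorem lintegral_weight_bump_le {s N W : ℝ} (hs : 0 ≤ s) (hN : 1 ≤ N) (hW : 0 < W)
    (hWN : 2 * W ≤ N / 2) {f : 𝓢(ℝ, ℂ)} {b : ℝ → ℝ} (hb : ∀ ξ, fhat f ξ = b ξ)
    (hb0 : ∀ ξ, 0 ≤ b ξ) (hb1 : ∀ ξ, b ξ ≤ 1) (hb2 : ∀ ξ, 2 * W ≤ |ξ - N| → b ξ = 0) :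
    ∫⁻ ξ, ENNReal.ofReal (weight s ξ * ‖fhat f ξ‖ ^ 2) ≤
      ENNReal.ofReal ((5 * N ^ 2) ^ s * (4 * W)) := by
  have hle : ∀ ξ, ENNReal.ofReal (weight s ξ * ‖fhat f ξ‖ ^ 2) ≤
      indicator (Icc (N - 2 * W) (N + 2 * W)) (fun _ => ENNReal.ofReal ((5 * N ^ 2) ^ s)) ξ := by
    intro ξ
    rw [hb, Complex.norm_real, Real.norm_of_nonneg (hb0 ξ)]
    by_cases hξ : ξ ∈ Icc (N - 2 * W) (N + 2 * W)
    · rw [indicator_of_mem hξ]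
      refine ENNReal.ofReal_le_ofReal ?_
      have h1 : b ξ ^ 2 ≤ 1 := pow_le_one₀ (hb0 ξ) (hb1 ξ)
      have h2 : weight s ξ ≤ (5 * N ^ 2) ^ s := by
        unfold weight
        refine Real.rpow_le_rpow (by positivity) ?_ hs
        nlinarith [hξ.1, hξ.2]
      calc weight s ξ * b ξ ^ 2 ≤ weight s ξ * 1 :=
            mul_le_mul_of_nonneg_left h1 (weight_pos s ξ).le
        _ ≤ _ := by rwa [mul_one]
    · rw [hb2 ξ]
      · simp
      · by_contra h
        obtain ⟨h1, h2⟩ := abs_lt.1 (not_le.1 h)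
        exact hξ ⟨by linarith, by linarith⟩
  refine (lintegral_mono hle).trans (le_of_eq ?_)
  rw [lintegral_indicator measurableSet_Icc, lintegral_const, Measure.restrict_apply_univ,
    Real.volume_Icc, ← ENNReal.ofReal_mul (by positivity)]
  congr 2
  ring

/-- Necessity: the estimate at regularity `s` forces `s ≥ α / 4` whenever `α ∈ (0, 1]` is such
that the dissipation is harmless up to time `N^{α-a}`. -/
theorem le_of_localMaximalEstimate {a γ s α : ℝ} (ha : 1 < a) (hγ : 0 < γ) (hs : 0 < s)
    (hα0 : 0 < α) (hα1 : α ≤ 1) (hα : γ * (α - a) ≤ -a) (h : LocalMaximalEstimate a γ s) :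
    α / 4 ≤ s := by
  obtain ⟨C, hC⟩ := h
  have ha1 : 0 < a - 1 := by linarith
  set D : ℝ := a * (a - 1) * 2 ^ a with hD
  have hD0 : 0 < D := by positivity
  -- With this `c`, the quadratic phase term stays below `1` up to time `c N ^ (α - a) / a`.
  set c : ℝ := 1 / (1 + D) with hc
  have hc0 : 0 < c := by positivity
  have hc1 : c ≤ 1 := by rw [hc, div_le_one (by positivity)]; linarith
  have hcD : c * D ≤ 1 := by
    rw [hc, one_div, inv_mul_le_iff₀ (by positivity)]; linarith
  set κ : ℝ := Real.exp (-2 ^ a) with hκ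
  have hκ0 : 0 < κ := Real.exp_pos _
  -- The tested inequality for the packet at frequency `N`.
  have key : ∀ N : ℝ, 1 ≤ N → κ ^ 2 * c * N ^ (α / 2 - 2 * s) ≤ C ^ 2 * 5 ^ s * 16 := by
    intro N hN
    have hN0 : 0 < N := by linarith
    set W : ℝ := N ^ (1 - α / 2) / 4 with hW
    have hW0 : 0 < W := by positivity
    have hWN : 2 * W ≤ N / 2 := by
      have : N ^ (1 - α / 2) ≤ N ^ (1 : ℝ) :=
        Real.rpow_le_rpow_of_exponent_le hN (by linarith)
      rw [Real.rpow_one] at this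
      rw [hW]; linarith
    obtain ⟨f, b, hb, hb0, hb1, hbW, hbz⟩ := exists_schwartz_fhat_bump N hW0
    set X : ℝ := c * N ^ (α - 1) with hX
    have hX0 : 0 < X := by positivity
    have hX1 : X ≤ 1 := by
      have : N ^ (α - 1) ≤ 1 := Real.rpow_le_one_of_one_le_of_nonpos hN (by linarith)
      have h0 : 0 < N ^ (α - 1) := by positivity
      nlinarith
    have hlow : ∀ x ∈ Ioo (-X) 0, ENNReal.ofReal (W * κ) ≤ maximalP a γ f x := by
      intro x hx
      set t : ℝ := -x / (a * N ^ (a - 1)) with ht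
      have hx0 : 0 < -x := by linarith [hx.2]
      have ht0 : 0 < t := by positivity
      have hta : t * a ≤ c * N ^ (α - a) := by
        have e : N ^ (α - 1) = N ^ (α - a) * N ^ (a - 1) := by
          rw [← Real.rpow_add hN0]; ring_nf
        have e2 : t * a = -x / N ^ (a - 1) := by rw [ht]; field_simp
        rw [e2, div_le_iff₀ (by positivity), mul_assoc, ← e]
        linarith [hx.1]
      have htc : t < c * N ^ (α - a) := by nlinarith
      have htN : t < N ^ (α - a) := by
        have : 0 < N ^ (α - a) := by positivity
        nlinarith
      have ht1 : t < 1 :=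
        htN.trans_le (Real.rpow_le_one_of_one_le_of_nonpos hN (by linarith))
      have hP : W * κ ≤ ‖P a γ t f x‖ := by
        refine le_norm_P_of_bump ha hN0 hW0 hWN ht0.le ?_ ?_ ?_ hb hb0 hbW hbz
        · rw [ht]; field_simp
        · rw [← hD]
          have e1 : (2 * W / N) ^ 2 = N ^ (-α) / 4 := by
            have : 2 * W / N = N ^ (-(α / 2)) / 2 := by
              rw [hW, show 1 - α / 2 = 1 + -(α / 2) by ring, Real.rpow_add hN0, Real.rpow_one]
              field_simp; norm_num
            rw [this, div_pow, ← Real.rpow_natCast (N ^ (-(α / 2))), ← Real.rpow_mul hN0.le]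
            push_cast
            ring_nf
          rw [e1]
          calc t * N ^ a * (D * (N ^ (-α) / 4))
              ≤ (c * N ^ (α - a)) * N ^ a * (D * (N ^ (-α) / 4)) := by gcongr
            _ = c * D / 4 * (N ^ (α - a) * N ^ a * N ^ (-α)) := by ring
            _ = c * D / 4 := by
                rw [← Real.rpow_add hN0, ← Real.rpow_add hN0]
                ring_nf
                simp
            _ ≤ 1 := by linarith
        · calc t ^ γ * (2 * N) ^ a ≤ (N ^ (α - a)) ^ γ * (2 * N) ^ a := by gcongr
            _ = 2 ^ a * N ^ (γ * (α - a) + a) := by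
                rw [← Real.rpow_mul hN0.le, Real.mul_rpow (by norm_num) hN0.le,
                  Real.rpow_add hN0]
                ring_nf
            _ ≤ 2 ^ a * 1 := by
                gcongr
                exact Real.rpow_le_one_of_one_le_of_nonpos hN (by linarith)
            _ = 2 ^ a := mul_one _
      calc ENNReal.ofReal (W * κ) ≤ ENNReal.ofReal ‖P a γ t f x‖ := ENNReal.ofReal_le_ofReal hP
        _ = ‖P a γ t f x‖ₑ := ofReal_norm _
        _ ≤ maximalP a γ f x :=
            le_iSup₂ (f := fun t (_ : t ∈ Ioo (0 : ℝ) 1) => ‖P a γ t f x‖ₑ) t ⟨ht0, ht1⟩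
    have hL2 : ENNReal.ofReal ((W * κ) ^ 2 * X) ≤
        ∫⁻ x in Icc (-1 : ℝ) 1, maximalP a γ f x ^ (2 : ℝ) := by
      calc ENNReal.ofReal ((W * κ) ^ 2 * X)
          = ∫⁻ _ in Ioo (-X) 0, ENNReal.ofReal (W * κ) ^ (2 : ℝ) := by
            rw [lintegral_const, Measure.restrict_apply_univ, Real.volume_Ioo,
              ENNReal.ofReal_rpow_of_nonneg (by positivity) zero_le_two, Real.rpow_two,
              ← ENNReal.ofReal_mul (by positivity)]
            congr 2
            ring
        _ ≤ ∫⁻ x in Ioo (-X) 0, maximalP a γ f x ^ (2 : ℝ) :=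
            setLIntegral_mono' measurableSet_Ioo fun x hx =>
              ENNReal.rpow_le_rpow (hlow x hx) zero_le_two
        _ ≤ _ := by
            have hsub : Ioo (-X) 0 ⊆ Icc (-1) 1 := fun x hx =>
              ⟨by linarith [hx.1], by linarith [hx.2]⟩
            exact lintegral_mono_set hsub
    have hf := hC f
    rw [sobolevNorm_eq, eLpNorm_eq_lintegral_rpow_enorm_toReal two_ne_zero
      ENNReal.ofNat_ne_top, ENNReal.toReal_ofNat] at hf
    simp only [enorm_eq_self] at hf
    have hf2 := ENNReal.rpow_le_rpow hf zero_le_two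
    rw [ENNReal.mul_rpow_of_nonneg _ _ zero_le_two, ← ENNReal.rpow_mul, ← ENNReal.rpow_mul,
      one_div_mul_cancel two_ne_zero, ENNReal.rpow_one, ENNReal.rpow_one] at hf2
    have hup := lintegral_weight_bump_le hs.le hN hW0 hWN hb hb0 hb1 hbz
    have hfin : ENNReal.ofReal ((W * κ) ^ 2 * X) ≤
        ENNReal.ofReal ((C : ℝ) ^ 2 * ((5 * N ^ 2) ^ s * (4 * W))) := by
      refine hL2.trans (hf2.trans ?_)
      rw [ENNReal.ofReal_mul (by positivity), ← ENNReal.ofReal_coe_nnreal,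
        ENNReal.ofReal_rpow_of_nonneg C.coe_nonneg zero_le_two, Real.rpow_two]
      gcongr
    rw [ENNReal.ofReal_le_ofReal_iff (by positivity)] at hfin
    have e5 : (5 * N ^ 2) ^ s = 5 ^ s * N ^ (2 * s) := by
      rw [Real.mul_rpow (by norm_num) (by positivity), Real.rpow_mul hN0.le, Real.rpow_two]
    have e6 : W * X = c * N ^ (α / 2) / 4 := by
      rw [hW, hX, show α / 2 = (1 - α / 2) + (α - 1) by ring, Real.rpow_add hN0]
      ring_nf
    have h7 : W * (κ ^ 2 * c * N ^ (α / 2)) ≤ W * (C ^ 2 * 5 ^ s * 16 * N ^ (2 * s)) := by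
      have : (W * κ) ^ 2 * X = W * (κ ^ 2 * (W * X)) := by ring
      rw [this, e6, e5] at hfin
      linarith
    have h8 := le_of_mul_le_mul_left h7 hW0
    rw [Real.rpow_sub hN0, ← mul_div_assoc, div_le_iff₀ (by positivity)]
    exact h8
  by_contra hlt
  have hpos : 0 < α / 2 - 2 * s := by linarith
  have ht : Filter.Tendsto (fun N : ℝ => κ ^ 2 * c * N ^ (α / 2 - 2 * s)) Filter.atTop
      Filter.atTop := (tendsto_rpow_atTop hpos).const_mul_atTop (by positivity)
  obtain ⟨N, hN1, hN2⟩ := ((Filter.eventually_ge_atTop (1 : ℝ)).and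
    (ht.eventually_gt_atTop (C ^ 2 * 5 ^ s * 16))).exists
  exact absurd (key N hN1) (not_le.2 hN2)

end ComplexTime

theorem theorem4p1 (a γ : ℝ) (ha : 1 < a) (hγ : 0 < γ) :
    IsGLB {s : ℝ | 0 < s ∧ ComplexTime.LocalMaximalEstimate a γ s}
      (min (1 / 4 * a * max 0 (1 - 1 / γ)) (1 / 4)) := by
  constructor
  · rintro s ⟨hs, h⟩
    rcases le_or_gt (1 - 1 / γ) 0 with hγ1 | hγ1
    · rw [max_eq_left hγ1, mul_zero]
      exact (min_le_left _ _).trans hs.le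
    · rw [max_eq_right hγ1.le]
      have hmin : min (1 / 4 * a * (1 - 1 / γ)) (1 / 4) = min (a * (1 - 1 / γ)) 1 / 4 := by
        rw [← min_div_div_right (by norm_num)]
        congr 1
        ring
      rw [hmin]
      refine ComplexTime.le_of_localMaximalEstimate ha hγ hs
        (lt_min (by positivity) one_pos) (min_le_right _ _) ?_ h
      have h1 : γ * min (a * (1 - 1 / γ)) 1 ≤ γ * (a * (1 - 1 / γ)) :=
        mul_le_mul_of_nonneg_left (min_le_left _ _) hγ.le
      have h2 : γ * (a * (1 - 1 / γ)) = γ * a - a := by field_simp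
      linarith
  · intro l hl
    refine le_of_forall_gt_imp_ge_of_dense fun s hs => hl ⟨?_, ?_⟩
    · exact lt_of_le_of_lt (le_min (by positivity) (by norm_num)) hs
    · exact ComplexTime.localMaximalEstimate_of_lt ha hγ
        (lt_of_le_of_lt (le_min (by positivity) (by norm_num)) hs) hs
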